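/- All graphs are finite and simple. A \emph{hole} of a graph $G$ is an induced cycle of length at least $4$; $G$ is \emph{chordal} if it has no hole. A \emph{hole cover} of $G$ is a nonempty set $C\subseteq V(G)$ meeting every hole of $G$. A vertex $u$ satisfies the \emph{NC property} if no hole containing $u$ shares two consecutive edges with a hole not containing $u$. A set $C\subseteq V(G)$ satisfies the NC property in $G$ if every vertex of $C$ does and every hole of $G$ contains at most one vertex of $C$. The graph $G$ satisfies the NC property if it has a hole cover satisfying the NC property in $G$. Locally chordalizing $G$ by a vertex $u$ means joining $u$ to every other vertex that lies on a common hole with $u$. If $C$ is a hole cover of $G$ satisfying the NC property in $G$, let $\widehat{G}(C)$ be the graph obtained by locally chordalizing successively by the vertices of $C$, each used once (the order is immaterial). A \emph{local chordalization partition} of a hole cover $\mathcal{C}$ of $G$ is an ordered partition $(C_1,\dots,C_k)$ of $\mathcal{C}$ such that, with $G_0^*=G-\mathcal{C}$ and, for $i=1,\dots,k$, $$V(G_i)=V(G_{i-1}^*)\cup C_i,\qquad E(G_i)=E(G_{i-1}^*)\cup E\Bigl(G-\bigcup_{j>i}C_j\Bigr),\qquad G_i^*=\widehat{G_i}(C_i),$$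 each $C_i$ is a hole cover of $G_i$ satisfying the NC property in $G_i$ and each $G_i^*$ is chordal. The \emph{non-chordality index} $i(G)$ is $0$ if $G$ is chordal; otherwise it is the smallest number $k$ of parts of a local chordalization partition of a hole cover of $G$. The DP-chromatic number $\chi_{DP}(G)$ is the least $k$ such that, for every assignment of a (not necessarily perfect) matching between $\{u\}\times\{1,\dots,k\}$ and $\{v\}\times\{1,\dots,k\}$ to each edge $uv$ of $G$, there is a map $f:V(G)\to\{1,\dots,k\}$ such that $(u,f(u))$ and $(v,f(v))$ are not matched for any edge $uv$. Let $\omega$ denote the clique number. A function $f:\mathbb{N}\to\mathbb{R}$ is a \emph{$\chi_{DP}$-binding function} for a class $\mathcal{F}$ of graphs if $\chi_{DP}(H)\le f(\omega(H))$ for every $G\in\mathcal{F}$ and every induced subgraph $H$ of $G$; the class $\mathcal{F}$ is \emph{$\chi_{DP}$-bounded} if it has such a function. \textbf{Theorem.} Let $k$ be a nonnegative integer and let $\mathcal{F}$ be a family of graphs with $i(G)\le k$ for every $G\in\mathcal{F}$. Then $f(x)=x+k$ is a $\chi_{DP}$-binding function for $\mathcal{F}$; in particular, $\mathcal{F}$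 is $\chi_{DP}$-bounded. Moreover, the class of graphs with the NC property is $\chi_{DP}$-bounded. -/

import Mathlib

universe u

namespace NonChordality

section Graph

variable {V : Type u}

/-- `S` is the vertex set of a hole of `G`, i.e. of an induced cycle of length at least four.
An induced cycle is determined by its vertex set: its edges are the edges of `G` inside `S`. -/
def IsHole (G : SimpleGraph V) (S : Set V) : Prop :=
  ∃ n : ℕ, 4 ≤ n ∧ ∃ φ : SimpleGraph.cycleGraph n ↪g G, Set.range φ = S

/-- A graph is chordal if it has no hole. -/
def IsChordal (G : SimpleGraph V) : Prop :=
  ∀ S : Set V, ¬ IsHole G S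

/-- A hole cover: a nonempty vertex set that meets every hole. -/
def IsHoleCover (G : SimpleGraph V) (C : Set V) : Prop :=
  C.Nonempty ∧ ∀ S : Set V, IsHole G S → (S ∩ C).Nonempty

/-- The holes on `S` and `T` share two consecutive edges `va`, `vb`. -/
def ShareConsecutiveEdges (G : SimpleGraph V) (S T : Set V) : Prop :=
  ∃ v a b : V, a ≠ b ∧ G.Adj v a ∧ G.Adj v b ∧
    v ∈ S ∩ T ∧ a ∈ S ∩ T ∧ b ∈ S ∩ T

/-- The vertex `u` satisfies the non-consecutive property: no hole through `u` shares consecutive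
edges with a hole avoiding `u`. -/
def VertexNC (G : SimpleGraph V) (u : V) : Prop :=
  ∀ S T : Set V, IsHole G S → IsHole G T → u ∈ S → u ∉ T → ¬ ShareConsecutiveEdges G S T

/-- The vertex set `C` satisfies the NC property in `G`. -/
def SetNC (G : SimpleGraph V) (C : Set V) : Prop :=
  (∀ u ∈ C, VertexNC G u) ∧ ∀ S : Set V, IsHole G S → (S ∩ C).Subsingleton

/-- The graph `G` satisfies the NC property. -/
def HasNC (G : SimpleGraph V) : Prop :=
  ∃ C : Set V, IsHoleCover G C ∧ SetNC G C

/-- Locally chordalize by `u` all the holes through `u`: join `u` to every other vertex that lies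
on a common hole with `u`. -/
def locallyChordalize (G : SimpleGraph V) (u : V) : SimpleGraph V :=
  G ⊔ SimpleGraph.fromRel (fun a b => a = u ∧ ∃ S : Set V, IsHole G S ∧ u ∈ S ∧ b ∈ S)

/-- `G'` arises from `G` by local chordalizations performed successively by the vertices of `C`,
each vertex used once, in some order. -/
def IsChordalizationBy (G : SimpleGraph V) (C : Set V) (G' : SimpleGraph V) : Prop :=
  ∃ l : List V, l.Nodup ∧ {v | v ∈ l} = C ∧ l.foldl locallyChordalize G = G'

/-- The graph `G - X`, kept on the vertex type `V`: the vertices of `X` lose all their edges.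
They then are isolated, so that they lie on no hole, and the holes, the hole covers contained in
the complement of `X`, the NC property and the local chordalizations are those of `G - X`. -/
def deleteSet (G : SimpleGraph V) (X : Set V) : SimpleGraph V :=
  (G.induce Xᶜ).spanningCoe

/-- `(C 0, …, C (k-1))` is a local chordalization partition of the hole cover `A` of `G`.
`Gs 0` is `G - A`; with `H i` the union of `Gs i` and `G - ⋃ j > i, C j`, the set `C i` is a hole
cover of `H i` satisfying the NC property, and `Gs (i + 1)` is the chordal graph obtained from
`H i` by local chordalizations by the vertices of `C i`. As in `deleteSet`, vertices not yet
included are kept as isolated vertices. -/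
def IsLocalChordalizationPartition (G : SimpleGraph V) (A : Set V) (k : ℕ)
    (C : Fin k → Set V) : Prop :=
  IsHoleCover G A ∧ Pairwise (fun i j => Disjoint (C i) (C j)) ∧ (⋃ i, C i) = A ∧
  ∃ (H : Fin k → SimpleGraph V) (Gs : Fin (k + 1) → SimpleGraph V),
    Gs 0 = deleteSet G A ∧
    ∀ i : Fin k,
      H i = Gs i.castSucc ⊔ deleteSet G (⋃ (j : Fin k) (_ : i < j), C j) ∧
      IsHoleCover (H i) (C i) ∧ SetNC (H i) (C i) ∧
      IsChordalizationBy (H i) (C i) (Gs i.succ) ∧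
      IsChordal (Gs i.succ)

open Classical in
/-- The non-chordality index of `G`: zero if `G` is chordal, and otherwise the smallest number of
parts of a local chordalization partition of a hole cover of `G`. -/
noncomputable def nonChordalityIndex (G : SimpleGraph V) : ℕ∞ :=
  if IsChordal G then 0
  else ⨅ (k : ℕ) (_ : ∃ (A : Set V) (C : Fin k → Set V),
    IsLocalChordalizationPartition G A k C), (k : ℕ∞)

/-- A `k`-correspondence assignment: a (partial) matching between `{u} × Fin k` and `{v} × Fin k`
for every edge `uv`. Only the values of `M` at adjacent pairs matter. -/
structure CorrespondenceAssignment (G : SimpleGraph V) (k : ℕ) where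
  /-- the colour `a` at `u` is matched with the colour `b` at `v` -/
  M : V → V → Fin k → Fin k → Prop
  symm : ∀ u v a b, G.Adj u v → M u v a b → M v u b a
  matching : ∀ u v a b b', G.Adj u v → M u v a b → M u v a b' → b = b'

/-- Every `k`-correspondence assignment admits a colouring: no edge has matched end colours. -/
def DPColorable (G : SimpleGraph V) (k : ℕ) : Prop :=
  ∀ L : CorrespondenceAssignment G k,
    ∃ f : V → Fin k, ∀ u v, G.Adj u v → ¬ L.M u v (f u) (f v)

/-- The DP-chromatic number (correspondence chromatic number). -/
noncomputable def dpChromaticNumber (G : SimpleGraph V) : ℕ :=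
  sInf {k : ℕ | DPColorable G k}

/-- On a finite graph the minimum defining the DP-chromatic number is over a nonempty set. -/
theorem dpColorable_card [Finite V] (G : SimpleGraph V) : DPColorable G (Nat.card V) := by
  classical
  have := Fintype.ofFinite V
  intro L
  rcases isEmpty_or_nonempty V with hV | hV
  · exact ⟨fun v => hV.elim v, fun v => hV.elim v⟩
  have : Nonempty (Fin (Nat.card V)) := ⟨⟨0, Nat.card_pos⟩⟩
  have key : ∀ s : Finset V, ∃ f : V → Fin (Nat.card V),
      ∀ u ∈ s, ∀ v ∈ s, G.Adj u v → ¬ L.M u v (f u) (f v) := by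
    intro s
    induction s using Finset.induction_on with
    | empty => exact ⟨fun _ => Classical.arbitrary _, by simp⟩
    | insert w s hw ih =>
      obtain ⟨f, hf⟩ := ih
      let g : V → Fin (Nat.card V) := fun u =>
        if h : ∃ b, L.M u w (f u) b then h.choose else Classical.arbitrary _
      have hcard : (s.image g).card < (Finset.univ : Finset (Fin (Nat.card V))).card := by
        have h1 : (insert w s).card ≤ Fintype.card V := Finset.card_le_univ _
        rw [Finset.card_insert_of_notMem hw] at h1
        have h2 : (s.image g).card ≤ s.card := Finset.card_image_le
        have h3 : Nat.card V = Fintype.card V := Nat.card_eq_fintype_card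
        have h4 : (Finset.univ : Finset (Fin (Nat.card V))).card = Nat.card V := Finset.card_fin _
        omega
      obtain ⟨c, -, hc⟩ := Finset.exists_mem_notMem_of_card_lt_card hcard
      have hcw : ∀ u ∈ s, G.Adj u w → ¬ L.M u w (f u) c := by
        intro u hu ha hm
        apply hc
        refine Finset.mem_image.2 ⟨u, hu, ?_⟩
        have h : ∃ b, L.M u w (f u) b := ⟨c, hm⟩
        simp only [g, dif_pos h]
        exact L.matching u w _ _ _ ha h.choose_spec hm
      have hne : ∀ u ∈ s, u ≠ w := fun u hu h => hw (h ▸ hu)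
      refine ⟨Function.update f w c, ?_⟩
      intro u hu v hv ha
      rcases Finset.mem_insert.1 hu with rfl | hu'
      · rcases Finset.mem_insert.1 hv with rfl | hv'
        · exact absurd ha (G.loopless.irrefl _)
        · rw [Function.update_self, Function.update_of_ne (hne v hv')]
          exact fun hm => hcw v hv' ha.symm (L.symm _ _ _ _ ha hm)
      · rcases Finset.mem_insert.1 hv with rfl | hv'
        · rw [Function.update_self, Function.update_of_ne (hne u hu')]
          exact hcw u hu' ha
        · rw [Function.update_of_ne (hne u hu'), Function.update_of_ne (hne v hv')]
          exact hf u hu' v hv' ha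
  obtain ⟨f, hf⟩ := key Finset.univ
  exact ⟨f, fun u v => hf u (Finset.mem_univ _) v (Finset.mem_univ _)⟩

end Graph

/-- A finite simple graph. -/
structure FiniteGraph where
  V : Type u
  [finite : Finite V]
  graph : SimpleGraph V

/-- `f` is a `χ_DP`-binding function for the class `F`: for every member of `F` and every induced
subgraph of it, the DP-chromatic number is at most `f` of the clique number. -/
def IsDPBindingFunction (F : Set FiniteGraph.{u}) (f : ℕ → ℝ) : Prop :=
  ∀ G ∈ F, ∀ s : Set G.V,
    (dpChromaticNumber (G.graph.induce s) : ℝ) ≤ f (G.graph.induce s).cliqueNum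

/-- The class `F` is `χ_DP`-bounded. -/
def IsDPBounded (F : Set FiniteGraph.{u}) : Prop :=
  ∃ f : ℕ → ℝ, IsDPBindingFunction F f

end NonChordality

/-!
If `G` has a chordal supergraph `G'` on the same vertices in which every clique becomes a clique of
`G` after the deletion of at most `d` vertices, then every induced subgraph `H` of `G` satisfies
`χ_DP(H) ≤ ω(H) + d`: both properties of `G'` pass to induced subgraphs, and a chordal graph is
greedily DP-colourable with `ω` colours along a perfect elimination order
(`IsChordal.exists_simplicial`, `IsChordal.dpColorable`). So it suffices to see that each round of
local chordalizations costs one vertex of a clique; for graphs with the NC property one round is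
enough.

The first point is that locally chordalizing by a vertex `u` with the NC property creates no hole
(`VertexNC.isHole_of_locallyChordalize`). A new hole would pass through `u`, and its vertices not
adjacent to `u` would form a connected set `P` of vertices on no old hole through `u`, joined to two
nonadjacent vertices `p`, `q` that are neighbours of `u` or on holes through `u`. If `p` is not a
neighbour of `u`, the NC property makes every connected set that leads from `P` to the
neighbourhood of `u` pass through or next to `p` (`VertexNC.mem_or_exists_adj`). Applied to
the two arcs between `u` and `q` of a hole, this shows that `p` has neighbours on both of them, and
`p` together with a subpath through `q` is a hole that violates the NC property.

Consequently all edges added in one round join a vertex of the cover to a vertex on a common hole of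
the graph at the start of the round. A similar argument (`SetNC.not_adj_of_common`) shows that the
added edges inside a clique all contain the same vertex of the cover, whose deletion leaves a clique
of the graph before the round (`IsChordalizationBy.exists_isClique`). Along a local chordalization
partition, the vertices that enter later bring only edges of `G`, so that the losses add up to at
most one per part (`IsStage`).
-/

namespace NonChordality

variable {V : Type u} {G : SimpleGraph V}

/-! ### Linked vertices and induced paths -/

/-- `a` and `b` are joined by a walk of `G` all of whose vertices lie in `Y`. -/
def LinkedIn (G : SimpleGraph V) (Y : Set V) (a b : V) : Prop :=
  a ∈ Y ∧ Relation.ReflTransGen (fun x y => G.Adj x y ∧ x ∈ Y ∧ y ∈ Y) a b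

theorem LinkedIn.refl {Y : Set V} {a : V} (h : a ∈ Y) : LinkedIn G Y a a := ⟨h, .refl⟩

theorem LinkedIn.trans {Y : Set V} {a b c : V} (h : LinkedIn G Y a b) (h' : LinkedIn G Y b c) :
    LinkedIn G Y a c := ⟨h.1, h.2.trans h'.2⟩

theorem LinkedIn.mem_right {Y : Set V} {a b : V} (h : LinkedIn G Y a b) : b ∈ Y := by
  obtain ⟨ha, h⟩ := h
  induction h with
  | refl => exact ha
  | tail _ h _ => exact h.2.2

theorem LinkedIn.symm {Y : Set V} {a b : V} (h : LinkedIn G Y a b) : LinkedIn G Y b a :=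
  have : Std.Symm (fun x y => G.Adj x y ∧ x ∈ Y ∧ y ∈ Y) :=
    ⟨fun _ _ h => ⟨h.1.symm, h.2.2, h.2.1⟩⟩
  ⟨h.mem_right, Relation.ReflTransGen.stdSymm.symm _ _ h.2⟩

theorem LinkedIn.mono {Y Z : Set V} {a b : V} (h : LinkedIn G Y a b) (hYZ : Y ⊆ Z) :
    LinkedIn G Z a b :=
  ⟨hYZ h.1, Relation.ReflTransGen.mono (fun _ _ h => ⟨h.1, hYZ h.2.1, hYZ h.2.2⟩) _ _ h.2⟩

theorem linkedIn_of_adj {Y : Set V} {a b : V} (h : G.Adj a b) (ha : a ∈ Y) (hb : b ∈ Y) :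
    LinkedIn G Y a b :=
  ⟨ha, .single ⟨h, ha, hb⟩⟩

theorem LinkedIn.exists_chain {Y : Set V} {a b : V} (h : LinkedIn G Y a b) :
    ∃ (n : ℕ) (f : ℕ → V), f 0 = a ∧ f n = b ∧ (∀ i ≤ n, f i ∈ Y) ∧
      ∀ i < n, G.Adj (f i) (f (i + 1)) := by
  obtain ⟨ha, h⟩ := h
  induction h with
  | refl => exact ⟨0, fun _ => a, rfl, rfl, fun _ _ => ha, by simp⟩
  | @tail b c _ hbc ih =>
    obtain ⟨n, f, h0, hn, hY, hadj⟩ := ih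
    refine ⟨n + 1, fun i => if i ≤ n then f i else c, by simpa using h0, by simp, ?_, ?_⟩
    · intro i hi
      by_cases h : i ≤ n
      · simpa [h] using hY i h
      · simpa [h] using hbc.2.2
    · intro i hi
      rcases Nat.lt_succ_iff_lt_or_eq.1 hi with h | rfl
      · simpa [h.le, Nat.succ_le_of_lt h] using hadj i h
      · simpa [hn] using hbc.1

theorem linkedIn_image {f : ℕ → V} {Y : Set V} {l r : ℕ} (hY : ∀ i, l ≤ i → i ≤ r → f i ∈ Y)
    (hadj : ∀ i, l ≤ i → i < r → G.Adj (f i) (f (i + 1))) {i j : ℕ} (hi : l ≤ i) (hij : i ≤ j)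
    (hj : j ≤ r) : LinkedIn G Y (f i) (f j) := by
  induction j, hij using Nat.le_induction with
  | base => exact .refl (hY i hi hj)
  | succ k hk ih =>
    exact (ih (by omega)).trans
      (linkedIn_of_adj (hadj k (by omega) (by omega)) (hY k (by omega) (by omega))
        (hY (k + 1) (by omega) hj))

/-- A shortest walk inside `Y` from `A` to `B` is an induced path whose interior avoids `A`
and `B`. -/
theorem LinkedIn.exists_inducedPath {Y A B : Set V} {a b : V} (h : LinkedIn G Y a b) (ha : a ∈ A)
    (hb : b ∈ B) :
    ∃ (n : ℕ) (f : ℕ → V), f 0 ∈ A ∧ f n ∈ B ∧ (∀ i ≤ n, f i ∈ Y) ∧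
      (∀ i j, i < j → j ≤ n → f i ≠ f j ∧ (G.Adj (f i) (f j) ↔ j = i + 1)) ∧
      (∀ i ≤ n, 0 < i → f i ∉ A) ∧ ∀ i < n, f i ∉ B := by
  classical
  let p : ℕ → Prop := fun n => ∃ f : ℕ → V, f 0 ∈ A ∧ f n ∈ B ∧ (∀ i ≤ n, f i ∈ Y) ∧
      ∀ i < n, G.Adj (f i) (f (i + 1))
  have hp : ∃ n, p n := by
    obtain ⟨n, f, h0, hn, h1, h2⟩ := h.exists_chain
    exact ⟨n, f, h0 ▸ ha, hn ▸ hb, h1, h2⟩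
  obtain ⟨f, h0, hn, hY, hadj⟩ := Nat.find_spec hp
  have hmin : ∀ m, p m → Nat.find hp ≤ m := fun m hm => Nat.find_min' hp hm
  generalize Nat.find hp = n at *
  -- A walk can be shortened whenever a later vertex can follow an earlier one directly.
  have hcut : ∀ i d, i + 1 + d ≤ n → 0 < d → ¬ G.Adj (f i) (f (i + 1 + d)) := by
    intro i d hid hd hA
    have : n ≤ n - d := by
      refine hmin _ ⟨fun k => if k ≤ i then f k else f (k + d), by simpa using h0, ?_, ?_, ?_⟩
      · have : ¬ n - d ≤ i := by omega
        simpa [this, Nat.sub_add_cancel (show d ≤ n by omega)] using hn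
      · intro k hk
        by_cases h : k ≤ i
        · simpa [h] using hY k (by omega)
        · simpa [h] using hY (k + d) (by omega)
      · intro k hk
        rcases lt_trichotomy k i with h | rfl | h
        · simpa [h.le, Nat.succ_le_of_lt h] using hadj k (by omega)
        · simpa using hA
        · have h1 : ¬ k ≤ i := by omega
          have h2 : ¬ k + 1 ≤ i := by omega
          simpa [h1, h2, add_right_comm] using hadj (k + d) (by omega)
    omega
  have hA : ∀ i ≤ n, 0 < i → f i ∉ A := by
    intro i hi hi0 hiA
    have : n ≤ n - i := by
      refine hmin _ ⟨fun k => f (k + i), by simpa using hiA, ?_, fun k hk => hY _ (by omega), ?_⟩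
      · simpa [Nat.sub_add_cancel hi] using hn
      · intro k hk
        simpa [add_right_comm] using hadj (k + i) (by omega)
    omega
  have hB : ∀ i < n, f i ∉ B := by
    intro i hi hiB
    have : n ≤ i := hmin _ ⟨f, h0, hiB, fun k hk => hY k (by omega), fun k hk => hadj k (by omega)⟩
    omega
  refine ⟨n, f, h0, hn, hY, ?_, hA, hB⟩
  intro i j hij hj
  refine ⟨fun he => ?_, fun h => ?_, fun h => h ▸ hadj i (by omega)⟩
  · rcases eq_or_lt_of_le hj with rfl | hlt
    · exact hB i hij (he ▸ hn)
    · have := hadj j hlt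
      rw [← he] at this
      obtain ⟨d, rfl⟩ := Nat.exists_eq_add_of_lt hij
      exact hcut i (d + 1) (by omega) (by omega) (by convert this using 2; omega)
  · by_contra hne
    obtain ⟨d, rfl⟩ := Nat.exists_eq_add_of_lt hij
    exact hcut i d (by omega) (by omega) (by convert h using 2; omega)

/-! ### Holes as cyclic sequences -/

/-- The sequence `f 0, …, f (n - 1)` runs once around an induced cycle of `G`. -/
def IsCyclicSeq (G : SimpleGraph V) (n : ℕ) (f : ℕ → V) : Prop :=
  ∀ i j, i < j → j < n → f i ≠ f j ∧ (G.Adj (f i) (f j) ↔ j = i + 1 ∨ (i = 0 ∧ j = n - 1))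

theorem cycleGraph_adj_of_lt {n : ℕ} {i j : Fin n} (h : i < j) :
    (SimpleGraph.cycleGraph n).Adj i j ↔ j.val = i.val + 1 ∨ (i.val = 0 ∧ j.val = n - 1) := by
  rw [SimpleGraph.cycleGraph_adj', Fin.sub_val_of_le h.le, Fin.coe_sub_iff_lt.2 h]
  have := j.2
  have : i.val < j.val := h
  omega

theorem IsCyclicSeq.isHole {n : ℕ} {f : ℕ → V} (h : IsCyclicSeq G n f) (hn : 4 ≤ n) :
    IsHole G (f '' {i | i < n}) := by
  have hinj : Function.Injective fun i : Fin n => f i := by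
    intro i j hij
    rcases lt_trichotomy i j with h' | h' | h'
    · exact absurd hij (h i j h' j.2).1
    · exact h'
    · exact absurd hij.symm (h j i h' i.2).1
  refine ⟨n, hn, ⟨⟨fun i => f i, hinj⟩, ?_⟩, ?_⟩
  · intro i j
    change G.Adj (f i) (f j) ↔ _
    rcases lt_trichotomy i j with h' | rfl | h'
    · rw [(h i j h' j.2).2, cycleGraph_adj_of_lt h']
    · simp
    · rw [SimpleGraph.adj_comm, (h j i h' i.2).2, SimpleGraph.adj_comm, cycleGraph_adj_of_lt h']
  · ext x
    constructor
    · rintro ⟨i, rfl⟩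
      exact ⟨i, i.2, rfl⟩
    · rintro ⟨i, hi, rfl⟩
      exact ⟨⟨i, hi⟩, rfl⟩

/-- A hole can be traversed starting from any of its vertices. -/
theorem IsHole.exists_isCyclicSeq {S : Set V} (hS : IsHole G S) {u : V} (hu : u ∈ S) :
    ∃ (n : ℕ) (f : ℕ → V), 4 ≤ n ∧ f 0 = u ∧ IsCyclicSeq G n f ∧ f '' {i | i < n} = S := by
  obtain ⟨n, hn, φ, rfl⟩ := hS
  obtain ⟨i₀, rfl⟩ := hu
  have : NeZero n := ⟨by omega⟩
  refine ⟨n, fun i => φ (i₀ + Fin.ofNat n i), hn, by simp, ?_, ?_⟩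
  · intro i j hij hj
    have hi : i < n := hij.trans hj
    have hne : Fin.ofNat n i < Fin.ofNat n j := by
      simpa [Fin.lt_def, Nat.mod_eq_of_lt hi, Nat.mod_eq_of_lt hj] using hij
    refine ⟨fun h => ?_, ?_⟩
    · exact hne.ne (add_left_cancel (φ.injective h))
    · have hval : (Fin.ofNat n i).val = i ∧ (Fin.ofNat n j).val = j := by
        simp [Nat.mod_eq_of_lt hi, Nat.mod_eq_of_lt hj]
      have key := cycleGraph_adj_of_lt hne
      rw [hval.1, hval.2] at key
      rw [φ.map_adj_iff, ← key, SimpleGraph.cycleGraph_adj', SimpleGraph.cycleGraph_adj']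
      simp only [add_sub_add_left_eq_sub]
  · ext x
    constructor
    · rintro ⟨i, -, rfl⟩
      exact ⟨_, rfl⟩
    · rintro ⟨i, rfl⟩
      refine ⟨(i - i₀).val, (i - i₀).2, ?_⟩
      simp

theorem IsHole.exists_adj {S : Set V} (hS : IsHole G S) {u : V} (hu : u ∈ S) : ∃ v, G.Adj u v := by
  obtain ⟨n, f, hn, rfl, hf, -⟩ := hS.exists_isCyclicSeq hu
  exact ⟨f 1, (hf 0 1 (by omega) (by omega)).2.2 (by omega)⟩

/-- Holes are found by the following principle: let `x ∉ Y` and let the neighbours of `x` in `Y`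
split into two parts `A` and `B` without edges between them. A shortest path inside `Y` from `A` to
`B` closes up to a hole through `x`. Since the path joins `A` to `B`, the hole contains an edge
leaving `Z` for every set `Z` that contains `A` and is disjoint from `B`. -/
theorem exists_isHole_of_linkedIn {x : V} {Y A B : Set V} {a b : V} (hxY : x ∉ Y)
    (h : LinkedIn G Y a b) (ha : a ∈ A) (hb : b ∈ B) (hA : ∀ y ∈ A, G.Adj x y)
    (hB : ∀ y ∈ B, G.Adj x y) (hY : ∀ y ∈ Y, G.Adj x y → y ∈ A ∨ y ∈ B)
    (hAB : ∀ y ∈ A, ∀ z ∈ B, y ≠ z ∧ ¬ G.Adj y z) :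
    ∃ T, IsHole G T ∧ x ∈ T ∧ T ⊆ insert x Y ∧ (T ∩ A).Nonempty ∧ (T ∩ B).Nonempty ∧
      ∀ Z : Set V, A ⊆ Z → (∀ y ∈ B, y ∉ Z) →
        ∃ z ∈ T, ∃ w ∈ T, z ∈ Z ∧ w ∉ Z ∧ w ≠ x ∧ z ∈ Y ∧ G.Adj z w := by
  obtain ⟨n, f, h0, hn, hfY, hf, hfA, hfB⟩ := h.exists_inducedPath ha hb
  have hn2 : 2 ≤ n := by
    by_contra hlt
    obtain rfl | rfl : n = 0 ∨ n = 1 := by omega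
    · exact (hAB _ h0 _ hn).1 rfl
    · exact (hAB _ h0 _ hn).2 ((hf 0 1 (by omega) le_rfl).2.2 rfl)
  let g : ℕ → V := fun i => if i = 0 then x else f (i - 1)
  have hg0 : g 0 = x := rfl
  have hgs : ∀ i, g (i + 1) = f i := fun i => by simp [g]
  have hg : IsCyclicSeq G (n + 2) g := by
    intro i j hij hj
    obtain ⟨j, rfl⟩ : ∃ k, j = k + 1 := ⟨j - 1, by omega⟩
    rcases Nat.eq_zero_or_pos i with rfl | hi
    · rw [hg0, hgs]
      refine ⟨fun h => hxY (h ▸ hfY j (by omega)), fun h => ?_, fun h => ?_⟩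
      · rcases hY _ (hfY j (by omega)) h with h' | h'
        · have : ¬ 0 < j := fun hj0 => hfA j (by omega) hj0 h'
          omega
        · have : ¬ j < n := fun hjn => hfB j hjn h'
          omega
      · obtain rfl | rfl : j = 0 ∨ j = n := by omega
        · exact hA _ h0
        · exact hB _ hn
    · obtain ⟨i, rfl⟩ : ∃ k, i = k + 1 := ⟨i - 1, by omega⟩
      rw [hgs, hgs]
      have := hf i j (by omega) (by omega)
      refine ⟨this.1, this.2.trans ?_⟩
      omega
  have hmem : ∀ i ≤ n, f i ∈ g '' {i | i < n + 2} := fun i hi => by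
    refine ⟨i + 1, ?_, hgs i⟩
    simp only [Set.mem_ofPred_eq]; omega
  refine ⟨_, hg.isHole (by omega), ⟨0, by simp, rfl⟩, ?_, ⟨_, hmem 0 (by omega), h0⟩,
    ⟨_, hmem n le_rfl, hn⟩, ?_⟩
  · rintro _ ⟨i, hi, rfl⟩
    rcases Nat.eq_zero_or_pos i with rfl | hi0
    · exact Or.inl rfl
    · obtain ⟨i, rfl⟩ : ∃ k, i = k + 1 := ⟨i - 1, by omega⟩
      rw [hgs]
      simp only [Set.mem_ofPred_eq] at hi
      exact Or.inr (hfY i (by omega))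
  · intro Z hAZ hBZ
    by_contra hcon
    push Not at hcon
    have : ∀ i ≤ n, f i ∈ Z := by
      intro i
      induction i with
      | zero => exact fun _ => hAZ h0
      | succ i ih =>
        intro hi
        by_contra hZ
        refine hcon (f i) (hmem i (by omega)) (f (i + 1)) (hmem (i + 1) hi) (ih (by omega)) hZ ?_
          (hfY i (by omega)) ((hf i (i + 1) (by omega) hi).2.2 rfl)
        exact fun h => hxY (h ▸ hfY (i + 1) hi)
    exact hBZ _ hn (this n le_rfl)

/-! ### The two arcs of a hole -/

/-- `A` behaves like the interior of an induced path from `v` to `w`: it is connected, contains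
neither `v` nor `w`, and each of `v` and `w` has exactly one neighbour in it. That `A` itself is a
path is not recorded. -/
structure IsArc (G : SimpleGraph V) (v w : V) (A : Set V) : Prop where
  linked : ∀ x ∈ A, ∀ y ∈ A, LinkedIn G A x y
  left : ∃ a ∈ A, G.Adj v a ∧ ∀ y ∈ A, G.Adj v y → y = a
  right : ∃ a ∈ A, G.Adj w a ∧ ∀ y ∈ A, G.Adj w y → y = a
  left_notMem : v ∉ A
  right_notMem : w ∉ A

/-- The nonadjacent vertices `v` and `w` split the hole `S` into the arcs `A` and `B`. -/
structure IsSplit (G : SimpleGraph V) (S : Set V) (v w : V) (A B : Set V) : Prop where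
  arc : IsArc G v w A
  arc' : IsArc G v w B
  separated : ∀ a ∈ A, ∀ b ∈ B, a ≠ b ∧ ¬ G.Adj a b
  eq : S = insert v (insert w (A ∪ B))

theorem IsSplit.symm {S : Set V} {v w : V} {A B : Set V} (h : IsSplit G S v w A B) :
    IsSplit G S v w B A :=
  ⟨h.arc', h.arc, fun b hb a ha =>
    ⟨(h.separated a ha b hb).1.symm, fun h' => (h.separated a ha b hb).2 h'.symm⟩,
    by rw [h.eq, Set.union_comm]⟩

/-- The part of a cyclic sequence strictly between two of its terms is an arc. -/
theorem IsCyclicSeq.isArc_between {n j : ℕ} {f : ℕ → V} (h : IsCyclicSeq G n f) (hj : 1 < j)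
    (hjn : j < n - 1) : IsArc G (f 0) (f j) (f '' {i | 0 < i ∧ i < j}) := by
  refine ⟨?_, ⟨f 1, ⟨1, by simpa using hj, rfl⟩, ?_, ?_⟩, ⟨f (j - 1), ⟨j - 1, ?_, rfl⟩, ?_, ?_⟩,
    ?_, ?_⟩
  · have key : ∀ a b, 0 < a → a ≤ b → b < j →
        LinkedIn G (f '' {i | 0 < i ∧ i < j}) (f a) (f b) := fun a b ha hab hb =>
      linkedIn_image (f := f) (l := 1) (r := j - 1)
        (fun i hi hi' => by exact ⟨i, ⟨by omega, by omega⟩, rfl⟩)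
        (fun i hi hi' => (h i (i + 1) (by omega) (by omega)).2.2 (Or.inl rfl)) ha hab (by omega)
    rintro _ ⟨a, ⟨ha, ha'⟩, rfl⟩ _ ⟨b, ⟨hb, hb'⟩, rfl⟩
    rcases le_total a b with hab | hab
    · exact key a b ha hab hb'
    · exact (key b a hb hab ha').symm
  · exact (h 0 1 (by omega) (by omega)).2.2 (by omega)
  · rintro _ ⟨i, ⟨hi, hi'⟩, rfl⟩ hadj
    have := (h 0 i hi (by omega)).2.1 hadj
    congr 1; omega
  · simp only [Set.mem_ofPred_eq]; omega
  · exact ((h (j - 1) j (by omega) (by omega)).2.2 (by omega)).symm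
  · rintro _ ⟨i, ⟨hi, hi'⟩, rfl⟩ hadj
    have := (h i j hi' (by omega)).2.1 hadj.symm
    congr 1; omega
  · rintro ⟨i, ⟨hi, hi'⟩, he⟩
    exact (h 0 i hi (by omega)).1 he.symm
  · rintro ⟨i, ⟨hi, hi'⟩, he⟩
    exact (h i j hi' (by omega)).1 he

theorem IsCyclicSeq.isArc_beyond {n j : ℕ} {f : ℕ → V} (h : IsCyclicSeq G n f) (hj : 1 < j)
    (hjn : j < n - 1) : IsArc G (f 0) (f j) (f '' {i | j < i ∧ i < n}) := by
  refine ⟨?_, ⟨f (n - 1), ⟨n - 1, ?_, rfl⟩, ?_, ?_⟩, ⟨f (j + 1), ⟨j + 1, ?_, rfl⟩, ?_, ?_⟩,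
    ?_, ?_⟩
  · have key : ∀ a b, j < a → a ≤ b → b < n →
        LinkedIn G (f '' {i | j < i ∧ i < n}) (f a) (f b) := fun a b ha hab hb =>
      linkedIn_image (f := f) (l := j + 1) (r := n - 1)
        (fun i hi hi' => by exact ⟨i, ⟨by omega, by omega⟩, rfl⟩)
        (fun i hi hi' => (h i (i + 1) (by omega) (by omega)).2.2 (Or.inl rfl)) ha hab (by omega)
    rintro _ ⟨a, ⟨ha, ha'⟩, rfl⟩ _ ⟨b, ⟨hb, hb'⟩, rfl⟩
    rcases le_total a b with hab | hab
    · exact key a b ha hab hb'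
    · exact (key b a hb hab ha').symm
  · simp only [Set.mem_ofPred_eq]; omega
  · exact (h 0 (n - 1) (by omega) (by omega)).2.2 (by omega)
  · rintro _ ⟨i, ⟨hi, hi'⟩, rfl⟩ hadj
    have := (h 0 i (by omega) (by omega)).2.1 hadj
    congr 1; omega
  · simp only [Set.mem_ofPred_eq]; omega
  · exact (h j (j + 1) (by omega) (by omega)).2.2 (by omega)
  · rintro _ ⟨i, ⟨hi, hi'⟩, rfl⟩ hadj
    have := (h j i hi hi').2.1 hadj
    congr 1; omega
  · rintro ⟨i, ⟨hi, hi'⟩, he⟩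
    exact (h 0 i (by omega) (by omega)).1 he.symm
  · rintro ⟨i, ⟨hi, hi'⟩, he⟩
    exact (h j i hi hi').1 he.symm

theorem IsHole.exists_isSplit {S : Set V} (hS : IsHole G S) {v w : V} (hv : v ∈ S) (hw : w ∈ S)
    (hne : v ≠ w) (hvw : ¬ G.Adj v w) : ∃ A B, IsSplit G S v w A B := by
  obtain ⟨n, f, hn, rfl, hf, rfl⟩ := hS.exists_isCyclicSeq hv
  obtain ⟨j, hj, rfl⟩ := hw
  simp only [Set.mem_ofPred_eq] at hj
  have hj0 : 0 < j := Nat.pos_of_ne_zero fun h => hne (by rw [h])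
  rw [(hf 0 j hj0 hj).2] at hvw
  refine ⟨_, _, hf.isArc_between (j := j) (by omega) (by omega),
    hf.isArc_beyond (by omega) (by omega), ?_, ?_⟩
  · rintro _ ⟨a, ⟨ha, ha'⟩, rfl⟩ _ ⟨b, ⟨hb, hb'⟩, rfl⟩
    refine ⟨(hf a b (by omega) hb').1, ?_⟩
    rw [(hf a b (by omega) hb').2]
    omega
  · ext y
    constructor
    · rintro ⟨i, hi, rfl⟩
      simp only [Set.mem_ofPred_eq] at hi
      rcases Nat.eq_zero_or_pos i with rfl | hi0
      · exact Or.inl rfl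
      rcases lt_trichotomy i j with h | rfl | h
      · exact Or.inr (Or.inr (Or.inl ⟨i, ⟨hi0, h⟩, rfl⟩))
      · exact Or.inr (Or.inl rfl)
      · exact Or.inr (Or.inr (Or.inr ⟨i, ⟨h, hi⟩, rfl⟩))
    · rintro (rfl | rfl | ⟨i, ⟨h, h'⟩, rfl⟩ | ⟨i, ⟨h, h'⟩, rfl⟩)
      · exact ⟨0, by simp only [Set.mem_ofPred_eq]; omega, rfl⟩
      · exact ⟨j, hj, rfl⟩
      · exact ⟨i, by simp only [Set.mem_ofPred_eq]; omega, rfl⟩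
      · exact ⟨i, h', rfl⟩

/-! ### Local chordalization by one vertex -/

theorem ShareConsecutiveEdges.symm {S T : Set V} (h : ShareConsecutiveEdges G S T) :
    ShareConsecutiveEdges G T S := by
  obtain ⟨v, a, b, h⟩ := h
  exact ⟨v, a, b, by simpa only [Set.inter_comm T S] using h⟩

theorem linkedIn_union {X F : Set V} (hX : ∀ x ∈ X, ∀ y ∈ X, LinkedIn G X x y)
    (hF : ∀ x ∈ F, ∀ y ∈ F, LinkedIn G F x y) (h : ∃ y ∈ F, y ∈ X ∨ ∃ a ∈ X, G.Adj a y) :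
    ∀ x ∈ X, ∀ y ∈ F, LinkedIn G (X ∪ F) x y := by
  intro x hx y hy
  obtain ⟨z, hz, h⟩ := h
  have hzy := (hF z hz y hy).mono (Set.subset_union_right (s := X))
  rcases h with h | ⟨a, ha, haz⟩
  · exact ((hX x hx z h).mono Set.subset_union_left).trans hzy
  · exact (((hX x hx a ha).mono Set.subset_union_left).trans
      (linkedIn_of_adj haz (Or.inl ha) (Or.inr hz))).trans hzy

theorem linkedIn_union_self {X F : Set V} (hX : ∀ x ∈ X, ∀ y ∈ X, LinkedIn G X x y)
    (hF : ∀ x ∈ F, ∀ y ∈ F, LinkedIn G F x y) (h : ∃ y ∈ F, y ∈ X ∨ ∃ a ∈ X, G.Adj a y) :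
    ∀ x ∈ X ∪ F, ∀ y ∈ X ∪ F, LinkedIn G (X ∪ F) x y := by
  have key := linkedIn_union hX hF h
  rintro x (hx | hx) y (hy | hy)
  · exact (hX x hx y hy).mono Set.subset_union_left
  · exact key x hx y hy
  · exact (key y hy x hx).symm
  · exact (hF x hx y hy).mono Set.subset_union_right

theorem linkedIn_singleton {v : V} : ∀ x ∈ ({v} : Set V), ∀ y ∈ ({v} : Set V),
    LinkedIn G {v} x y := by
  rintro x rfl y rfl
  exact .refl rfl

/-- If a vertex `x` off the hole `R` has a neighbour in each of the two arcs between `v` and `w`,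
then some hole consists of `x` and of a subpath of `R` having `w` as an interior vertex. -/
theorem IsSplit.exists_isHole {R : Set V} {v w x : V} {A B : Set V} (h : IsSplit G R v w A B)
    (hx : x ∉ R) (hxw : ¬ G.Adj x w) (hA : ∃ a ∈ A, G.Adj x a) (hB : ∃ b ∈ B, G.Adj x b) :
    ∃ T, IsHole G T ∧ x ∈ T ∧ w ∈ T ∧ T ⊆ insert x (insert w (A ∪ B)) ∧
      ShareConsecutiveEdges G T R := by
  obtain ⟨a, ha, hxa⟩ := hA
  obtain ⟨b, hb, hxb⟩ := hB
  have hsub : insert w (A ∪ B) ⊆ R := h.eq ▸ Set.subset_insert _ _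
  have hxY : x ∉ insert w (A ∪ B) := fun h' => hx (hsub h')
  have hwA : w ∈ insert w (A ∪ B) := Or.inl rfl
  have hAY : A ⊆ insert w (A ∪ B) := fun _ h => Or.inr (Or.inl h)
  have hBY : B ⊆ insert w (A ∪ B) := fun _ h => Or.inr (Or.inr h)
  have hlink : LinkedIn G (insert w (A ∪ B)) a b := by
    obtain ⟨a', ha', hwa', -⟩ := h.arc.right
    obtain ⟨b', hb', hwb', -⟩ := h.arc'.right
    exact ((((h.arc.linked a ha a' ha').mono hAY).trans
      (linkedIn_of_adj hwa'.symm (hAY ha') hwA)).trans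
      (linkedIn_of_adj hwb' hwA (hBY hb'))).trans ((h.arc'.linked b' hb' b hb).mono hBY)
  obtain ⟨T, hT, hxT, hTsub, -, -, hcross⟩ := exists_isHole_of_linkedIn
    (A := {y | y ∈ A ∧ G.Adj x y}) (B := {y | y ∈ B ∧ G.Adj x y}) hxY hlink ⟨ha, hxa⟩ ⟨hb, hxb⟩
    (fun y hy => hy.2) (fun y hy => hy.2)
    (by
      rintro y (rfl | hy | hy) hxy
      · exact absurd hxy hxw
      · exact Or.inl ⟨hy, hxy⟩
      · exact Or.inr ⟨hy, hxy⟩)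
    (fun y hy z hz => h.separated y hy.1 z hz.1)
  -- The path from `A` to `B` enters and leaves `w`.
  obtain ⟨a₁, ha₁T, w₁, hw₁T, ha₁, hw₁, hw₁x, -, hadj₁⟩ := hcross A (fun _ h => h.1)
    (fun y hy hyA => (h.separated y hyA y hy.1).1 rfl)
  have hww : w₁ = w := by
    rcases hTsub hw₁T with h' | h' | h' | h'
    · exact absurd h' hw₁x
    · exact h'
    · exact absurd h' hw₁
    · exact absurd hadj₁ (h.separated _ ha₁ _ h').2
  subst hww
  obtain ⟨a₂, ha₂T, b₁, hb₁T, ha₂, hb₁, hb₁x, -, hadj₂⟩ := hcross (insert w₁ A)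
    (fun _ h => Or.inr h.1) (by
      rintro y hy (rfl | hyA)
      · exact h.arc'.right_notMem hy.1
      · exact (h.separated y hyA y hy.1).1 rfl)
  have hb₁B : b₁ ∈ B := by
    rcases hTsub hb₁T with h' | h' | h' | h'
    · exact absurd h' hb₁x
    · exact absurd (Or.inl h') hb₁
    · exact absurd (Or.inr h') hb₁
    · exact h'
  have ha₂w : a₂ = w₁ := by
    rcases ha₂ with h' | h'
    · exact h'
    · exact absurd hadj₂ (h.separated _ h' _ hb₁B).2
  subst ha₂w
  exact ⟨T, hT, hxT, hw₁T, hTsub, a₂, a₁, b₁, (h.separated _ ha₁ _ hb₁B).1, hadj₁.symm, hadj₂,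
    ⟨hw₁T, hsub hwA⟩, ⟨ha₁T, hsub (hAY ha₁)⟩, ⟨hb₁T, hsub (hBY hb₁B)⟩⟩

/-- Let `p` be a nonneighbour of `u` on a hole `S` through `u`, and let `P` be a connected set of
nonneighbours of `u` on no hole through `u`, with `p` adjacent to `P`. Every connected set `F`
joining `P` to the neighbourhood of `u` meets the closed neighbourhood of `p`. Otherwise `F` cannot
touch both arcs of `S` between `u` and `p`, as that would yield a hole through `p` and its two
neighbours on `S` that avoids `u`. If `F` does not touch the arc `A`, then a shortest path from `A`
to the neighbours of `u` in `F` runs through `P`, and closes up to a hole through `u`. -/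
theorem VertexNC.mem_or_exists_adj {u p : V} (hu : VertexNC G u) {S P F : Set V} (hS : IsHole G S)
    (huS : u ∈ S) (hpS : p ∈ S) (hup : u ≠ p) (hadj : ¬ G.Adj u p)
    (hP : ∀ x ∈ P, ∀ y ∈ P, LinkedIn G P x y) (huP : u ∉ P) (hPadj : ∀ x ∈ P, ¬ G.Adj u x)
    (hPhole : ∀ x ∈ P, ∀ T, IsHole G T → u ∈ T → x ∉ T) (hpP : ∃ x ∈ P, G.Adj p x)
    (hF : ∀ x ∈ F, ∀ y ∈ F, LinkedIn G F x y) (huF : u ∉ F) (hFu : ∃ y ∈ F, G.Adj u y)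
    (hPF : ∃ y ∈ F, ∃ x ∈ P, G.Adj x y) :
    p ∈ F ∨ ∃ y ∈ F, G.Adj p y := by
  by_contra hcon
  push Not at hcon
  obtain ⟨hpF, hpFadj⟩ := hcon
  obtain ⟨A, B, hAB⟩ := hS.exists_isSplit huS hpS hup hadj
  have hboth : ¬ ((∃ y ∈ F, y ∈ A ∨ ∃ a ∈ A, G.Adj a y) ∧
      (∃ y ∈ F, y ∈ B ∨ ∃ a ∈ B, G.Adj a y)) := by
    rintro ⟨hA, hB⟩
    obtain ⟨a, ha, hpa, ha'⟩ := hAB.arc.right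
    obtain ⟨b, hb, hpb, hb'⟩ := hAB.arc'.right
    obtain ⟨y, hy, -⟩ := id hA
    have hlink : LinkedIn G (A ∪ B ∪ F) a b :=
      ((linkedIn_union hAB.arc.linked hF hA a ha y hy).mono
        (Set.union_subset_union_left _ Set.subset_union_left)).trans
      ((linkedIn_union hAB.arc'.linked hF hB b hb y hy).symm.mono
        (Set.union_subset_union_left _ Set.subset_union_right))
    obtain ⟨T, hT, hpT, hTsub, ⟨a₁, ha₁, rfl⟩, ⟨b₁, hb₁, rfl⟩, -⟩ := exists_isHole_of_linkedIn
      (x := p) (A := {a}) (B := {b}) (by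
        rintro ((h | h) | h)
        · exact hAB.arc.right_notMem h
        · exact hAB.arc'.right_notMem h
        · exact hpF h) hlink rfl rfl (by rintro _ rfl; exact hpa) (by rintro _ rfl; exact hpb)
      (by
        rintro y ((h | h) | h) hpy
        · exact Or.inl (ha' y h hpy)
        · exact Or.inr (hb' y h hpy)
        · exact absurd hpy (hpFadj y h))
      (by rintro _ rfl _ rfl; exact hAB.separated _ ha _ hb)
    refine hu S T hS hT huS ?_ ⟨p, a₁, b₁, (hAB.separated _ ha _ hb).1, hpa, hpb, ⟨hpS, hpT⟩,
      ⟨?_, ha₁⟩, ⟨?_, hb₁⟩⟩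
    · intro huT
      rcases hTsub huT with h | (h | h) | h
      · exact hup h
      · exact hAB.arc.left_notMem h
      · exact hAB.arc'.left_notMem h
      · exact huF h
    · rw [hAB.eq]; exact Or.inr (Or.inr (Or.inl ha))
    · rw [hAB.eq]; exact Or.inr (Or.inr (Or.inr hb))
  have hone : ∀ A B, IsSplit G S u p A B → ∃ y ∈ F, y ∈ A ∨ ∃ a ∈ A, G.Adj a y := by
    intro A B hAB
    by_contra hA
    push Not at hA
    obtain ⟨a, ha, hua, ha'⟩ := hAB.arc.left
    obtain ⟨y, hy, huy⟩ := hFu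
    have hAp : ∀ x ∈ A ∪ {p}, ∀ y ∈ A ∪ {p}, LinkedIn G (A ∪ {p}) x y := by
      obtain ⟨c, hc, hpc, -⟩ := hAB.arc.right
      exact linkedIn_union_self hAB.arc.linked linkedIn_singleton ⟨p, rfl, Or.inr ⟨c, hc, hpc.symm⟩⟩
    have hAPF : ∀ x ∈ A ∪ {p} ∪ P, ∀ y ∈ F, LinkedIn G (A ∪ {p} ∪ P ∪ F) x y := by
      obtain ⟨x, hx, hpx⟩ := hpP
      obtain ⟨z, hz, x', hx', hxz⟩ := hPF
      exact linkedIn_union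
        (linkedIn_union_self hAp hP ⟨x, hx, Or.inr ⟨p, Or.inr rfl, hpx⟩⟩) hF
        ⟨z, hz, Or.inr ⟨x', Or.inr hx', hxz⟩⟩
    obtain ⟨T, hT, huT, hTsub, -, -, hcross⟩ := exists_isHole_of_linkedIn
      (x := u) (A := {a}) (B := {y | y ∈ F ∧ G.Adj u y}) (by
        rintro (((h | h) | h) | h)
        · exact hAB.arc.left_notMem h
        · exact hup h
        · exact huP h
        · exact huF h) (hAPF a (Or.inl (Or.inl ha)) y hy) rfl ⟨hy, huy⟩
      (by rintro _ rfl; exact hua) (fun y hy => hy.2)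
      (by
        rintro z (((h | h) | h) | h) huz
        · exact Or.inl (ha' z h huz)
        · exact absurd (h ▸ huz) hadj
        · exact absurd huz (hPadj z h)
        · exact Or.inr ⟨h, huz⟩)
      (by
        rintro _ rfl z hz
        exact ⟨fun h => (hA z hz.1).1 (h ▸ ha), fun h => (hA z hz.1).2 _ ha h⟩)
    have hTP : ∀ z ∈ T, z ∉ P := fun z hz hzP => hPhole z hzP T hT huT hz
    obtain ⟨z, hzT, w, hwT, hz, hw, hwu, -, hzw⟩ := hcross (A ∪ {p})
      (by rintro _ rfl; exact Or.inl ha) (by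
        rintro z hz (h | h)
        · exact (hA z hz.1).1 h
        · exact hpF (h ▸ hz.1))
    have hwF : w ∈ F := by
      rcases hTsub hwT with h | (h | h) | h
      · exact absurd h hwu
      · exact absurd h hw
      · exact absurd h (hTP w hwT)
      · exact h
    rcases hz with h | h
    · exact (hA w hwF).2 z h hzw
    · exact hpFadj w hwF (h ▸ hzw)
  exact hboth ⟨hone A B hAB, hone B A hAB.symm⟩

theorem locallyChordalize_adj {u a b : V} : (locallyChordalize G u).Adj a b ↔
    G.Adj a b ∨ (a ≠ b ∧ (a = u ∨ b = u) ∧ ∃ S, IsHole G S ∧ a ∈ S ∧ b ∈ S) := by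
  simp only [locallyChordalize, SimpleGraph.sup_adj, SimpleGraph.fromRel_adj]
  constructor
  · rintro (h | ⟨hne, ⟨rfl, S, hS, ha, hb⟩ | ⟨rfl, S, hS, ha, hb⟩⟩)
    · exact Or.inl h
    · exact Or.inr ⟨hne, Or.inl rfl, S, hS, ha, hb⟩
    · exact Or.inr ⟨hne, Or.inr rfl, S, hS, hb, ha⟩
  · rintro (h | ⟨hne, rfl | rfl, S, hS, ha, hb⟩)
    · exact Or.inl h
    · exact Or.inr ⟨hne, Or.inl ⟨rfl, S, hS, ha, hb⟩⟩
    · exact Or.inr ⟨hne, Or.inr ⟨rfl, S, hS, hb, ha⟩⟩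

theorem le_locallyChordalize (G : SimpleGraph V) (u : V) : G ≤ locallyChordalize G u :=
  le_sup_left

theorem locallyChordalize_adj_of_ne {u a b : V} (ha : a ≠ u) (hb : b ≠ u) :
    (locallyChordalize G u).Adj a b ↔ G.Adj a b := by
  simp [locallyChordalize_adj, ha, hb]

/-- If `p` and `q` are nonadjacent and each is a neighbour of `u` or on a hole through `u`, then
they cannot both be adjacent to a connected set `P` of nonneighbours of `u` lying on no hole
through `u`. -/
theorem VertexNC.no_hidden_connection {u p q : V} (hu : VertexNC G u) {P : Set V}
    (hP : ∀ x ∈ P, ∀ y ∈ P, LinkedIn G P x y) (huP : u ∉ P) (hPadj : ∀ x ∈ P, ¬ G.Adj u x)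
    (hPhole : ∀ x ∈ P, ∀ T, IsHole G T → u ∈ T → x ∉ T) (hpu : p ≠ u) (hqu : q ≠ u)
    (hp : G.Adj u p ∨ ∃ S, IsHole G S ∧ u ∈ S ∧ p ∈ S)
    (hq : G.Adj u q ∨ ∃ S, IsHole G S ∧ u ∈ S ∧ q ∈ S)
    (hpP : ∃ x ∈ P, G.Adj p x) (hqP : ∃ x ∈ P, G.Adj q x) (hpq : p ≠ q) (hpqadj : ¬ G.Adj p q) :
    False := by
  by_cases hup : G.Adj u p <;> by_cases huq : G.Adj u q
  · -- Two neighbours of `u` are joined through `P` to a hole containing `u` and meeting `P`.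
    have hpPq : LinkedIn G ({p} ∪ P ∪ {q}) p q := by
      obtain ⟨x, hx, hpx⟩ := hpP
      obtain ⟨y, hy, hqy⟩ := hqP
      exact linkedIn_union (linkedIn_union_self linkedIn_singleton hP
        ⟨x, hx, Or.inr ⟨p, rfl, hpx⟩⟩) linkedIn_singleton
        ⟨q, rfl, Or.inr ⟨y, Or.inr hy, hqy.symm⟩⟩ p (Or.inl rfl) q rfl
    obtain ⟨T, hT, huT, hTsub, -, -, hcross⟩ := exists_isHole_of_linkedIn (x := u)
      (A := {p}) (B := {q}) (by
        rintro ((h | h) | h)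
        · exact hpu h.symm
        · exact huP h
        · exact hqu h.symm) hpPq rfl rfl (by rintro _ rfl; exact hup) (by rintro _ rfl; exact huq)
      (by
        rintro y ((h | h) | h) huy
        · exact Or.inl h
        · exact absurd huy (hPadj y h)
        · exact Or.inr h)
      (by rintro _ rfl _ rfl; exact ⟨hpq, hpqadj⟩)
    obtain ⟨_, -, w, hwT, rfl, hw, hwu, -, hzw⟩ := hcross {p} subset_rfl
      (by rintro _ rfl h; exact hpq h.symm)
    rcases hTsub hwT with h | (h | h) | h
    · exact hwu h
    · exact hw h
    · exact hPhole w h T hT huT hwT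
    · exact hpqadj (h ▸ hzw)
  · obtain ⟨S, hS, huS, hqS⟩ := hq.resolve_left huq
    obtain ⟨x, hx, hpx⟩ := hpP
    rcases hu.mem_or_exists_adj (F := {p}) hS huS hqS hqu.symm huq hP huP hPadj hPhole hqP
      linkedIn_singleton hpu.symm ⟨p, rfl, hup⟩ ⟨p, rfl, x, hx, hpx.symm⟩ with h | ⟨_, rfl, h⟩
    · exact hpq h.symm
    · exact hpqadj h.symm
  · obtain ⟨S, hS, huS, hpS⟩ := hp.resolve_left hup
    obtain ⟨x, hx, hqx⟩ := hqP
    rcases hu.mem_or_exists_adj (F := {q}) hS huS hpS hpu.symm hup hP huP hPadj hPhole hpP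
      linkedIn_singleton hqu.symm ⟨q, rfl, huq⟩ ⟨q, rfl, x, hx, hqx.symm⟩ with h | ⟨_, rfl, h⟩
    · exact hpq h
    · exact hpqadj h
  · -- The vertex `p` sees both arcs between `u` and `q` of a hole `R` through `u` and `q`.
    obtain ⟨S, hS, huS, hpS⟩ := hp.resolve_left hup
    obtain ⟨R, hR, huR, hqR⟩ := hq.resolve_left huq
    obtain ⟨x, hx, hqx⟩ := hqP
    have harc : ∀ A, IsArc G u q A → p ∈ A ∨ ∃ y ∈ A, G.Adj p y := by
      intro A hA
      obtain ⟨a, ha, hua, -⟩ := hA.left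
      obtain ⟨c, hc, hqc, -⟩ := hA.right
      rcases hu.mem_or_exists_adj (F := A ∪ {q}) hS huS hpS hpu.symm hup hP huP hPadj hPhole hpP
        (linkedIn_union_self hA.linked linkedIn_singleton ⟨q, rfl, Or.inr ⟨c, hc, hqc.symm⟩⟩)
        (by
          rintro (h | h)
          · exact hA.left_notMem h
          · exact hqu h.symm) ⟨a, Or.inl ha, hua⟩ ⟨q, Or.inr rfl, x, hx, hqx.symm⟩
        with (h | h) | ⟨y, h | h, hpy⟩
      · exact Or.inl h
      · exact absurd h hpq
      · exact Or.inr ⟨y, h, hpy⟩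
      · exact absurd (h ▸ hpy) hpqadj
    obtain ⟨A, B, hAB⟩ := hR.exists_isSplit huR hqR hqu.symm huq
    have hnot : ∀ A B, IsSplit G R u q A B → p ∉ A := by
      intro A B hAB hpA
      rcases harc B hAB.arc' with h | ⟨y, hy, hpy⟩
      · exact (hAB.separated p hpA p h).1 rfl
      · exact (hAB.separated p hpA y hy).2 hpy
    have hpA := hnot A B hAB
    have hpB := hnot B A hAB.symm
    obtain ⟨T, hT, -, -, hTsub, hshare⟩ := hAB.exists_isHole (x := p) (by
        rw [hAB.eq]
        rintro (h | h | h | h)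
        exacts [hpu h, hpq h, hpA h, hpB h]) hpqadj
      ((harc A hAB.arc).resolve_left hpA) ((harc B hAB.arc').resolve_left hpB)
    refine hu R T hR hT huR (fun huT => ?_) hshare.symm
    rcases hTsub huT with h | h | h | h
    exacts [hpu h.symm, hqu h.symm, hAB.arc.left_notMem h, hAB.arc'.left_notMem h]

/-- Locally chordalizing by a vertex with the NC property destroys all holes through that vertex
and creates no new holes. -/
theorem VertexNC.isHole_of_locallyChordalize {u : V} (hu : VertexNC G u) {T : Set V}
    (hT : IsHole (locallyChordalize G u) T) : IsHole G T ∧ u ∉ T := by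
  have huT : u ∉ T := by
    intro huT
    obtain ⟨n, f, hn, rfl, hf, -⟩ := hT.exists_isCyclicSeq huT
    have hne : ∀ i, 0 < i → i < n → f i ≠ f 0 := fun i hi hin => (hf 0 i hi hin).1.symm
    have hadj : ∀ i j, 0 < i → i < j → j < n → (G.Adj (f i) (f j) ↔ j = i + 1) := by
      intro i j hi hij hj
      rw [← locallyChordalize_adj_of_ne (hne i hi (by omega)) (hne j (by omega) hj),
        (hf i j hij hj).2]
      omega
    have hnot : ∀ i, 2 ≤ i → i ≤ n - 2 → ¬ G.Adj (f 0) (f i) ∧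
        ∀ S, IsHole G S → f 0 ∈ S → f i ∉ S := by
      intro i hi hin
      have h0 : ¬ (locallyChordalize G (f 0)).Adj (f 0) (f i) := by
        rw [(hf 0 i (by omega) (by omega)).2]; omega
      refine ⟨fun h => h0 (le_locallyChordalize _ _ h), fun S hS h1 h2 => h0 ?_⟩
      exact locallyChordalize_adj.2
        (Or.inr ⟨(hf 0 i (by omega) (by omega)).1, Or.inl rfl, S, hS, h1, h2⟩)
    have hyes : ∀ i, 0 < i → i < n → (locallyChordalize G (f 0)).Adj (f 0) (f i) →
        G.Adj (f 0) (f i) ∨ ∃ S, IsHole G S ∧ f 0 ∈ S ∧ f i ∈ S := by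
      intro i hi hin h
      rcases locallyChordalize_adj.1 h with h | ⟨-, -, h⟩
      · exact Or.inl h
      · exact Or.inr h
    refine hu.no_hidden_connection (p := f 1) (q := f (n - 1)) (P := f '' {i | 2 ≤ i ∧ i ≤ n - 2})
      ?_ ?_ ?_ ?_ (hne 1 (by omega) (by omega)) (hne (n - 1) (by omega) (by omega))
      (hyes 1 (by omega) (by omega) ((hf 0 1 (by omega) (by omega)).2.2 (by omega)))
      (hyes (n - 1) (by omega) (by omega) ((hf 0 (n - 1) (by omega) (by omega)).2.2 (by omega)))
      ⟨f 2, ⟨2, by simp only [Set.mem_ofPred_eq]; omega, rfl⟩, ?_⟩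
      ⟨f (n - 2), ⟨n - 2, by simp only [Set.mem_ofPred_eq]; omega, rfl⟩, ?_⟩
      (hf 1 (n - 1) (by omega) (by omega)).1 ?_
    · have key : ∀ a b, 2 ≤ a → a ≤ b → b ≤ n - 2 →
          LinkedIn G (f '' {i | 2 ≤ i ∧ i ≤ n - 2}) (f a) (f b) := fun a b ha hab hb =>
        linkedIn_image (f := f) (l := 2) (r := n - 2)
        (fun i hi hi' => by exact ⟨i, ⟨hi, hi'⟩, rfl⟩)
          (fun i hi hi' => (hadj i (i + 1) (by omega) (by omega) (by omega)).2 rfl) ha hab hb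
      rintro _ ⟨a, ⟨ha, ha'⟩, rfl⟩ _ ⟨b, ⟨hb, hb'⟩, rfl⟩
      rcases le_total a b with hab | hab
      · exact key a b ha hab hb'
      · exact (key b a hb hab ha').symm
    · rintro ⟨i, ⟨hi, hi'⟩, he⟩
      exact hne i (by omega) (by omega) he
    · rintro _ ⟨i, ⟨hi, hi'⟩, rfl⟩
      exact (hnot i hi hi').1
    · rintro _ ⟨i, ⟨hi, hi'⟩, rfl⟩
      exact (hnot i hi hi').2
    · exact (hadj 1 2 (by omega) (by omega) (by omega)).2 rfl
    · exact ((hadj (n - 2) (n - 1) (by omega) (by omega) (by omega)).2 (by omega)).symm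
    · rw [hadj 1 (n - 1) (by omega) (by omega) (by omega)]
      omega
  refine ⟨?_, huT⟩
  obtain ⟨n, hn, φ, rfl⟩ := hT
  have hφ : ∀ i, φ i ≠ u := fun i h => huT ⟨i, h⟩
  refine ⟨n, hn, ⟨φ.toEmbedding, fun {i j} => ?_⟩, rfl⟩
  rw [← φ.map_adj_iff]
  exact (locallyChordalize_adj_of_ne (hφ i) (hφ j)).symm

/-! ### Local chordalization by a set of vertices -/

/-- Successive local chordalizations by vertices with the NC property create no holes and leave none
through these vertices; the edges they add join one of these vertices to a vertex on a common hole
of the original graph. -/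
theorem foldl_locallyChordalize (l : List V) : ∀ (G : SimpleGraph V), (∀ u ∈ l, VertexNC G u) →
    G ≤ l.foldl locallyChordalize G ∧
    (∀ T, IsHole (l.foldl locallyChordalize G) T → IsHole G T ∧ ∀ u ∈ l, u ∉ T) ∧
    ∀ a b, (l.foldl locallyChordalize G).Adj a b → ¬ G.Adj a b →
      (a ∈ l ∨ b ∈ l) ∧ ∃ S, IsHole G S ∧ a ∈ S ∧ b ∈ S := by
  induction l with
  | nil => exact fun G _ => ⟨le_rfl, fun T hT => ⟨hT, by simp⟩, fun a b h h' => absurd h h'⟩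
  | cons u l ih =>
    intro G hG
    have hu : VertexNC G u := hG u (by simp)
    obtain ⟨h1, h2, h3⟩ := ih (locallyChordalize G u) (by
      rintro v hv S T hS hT hvS hvT ⟨w, a, b, hab, hwa, hwb, hw, ha, hb⟩
      have hS' := hu.isHole_of_locallyChordalize hS
      have hT' := hu.isHole_of_locallyChordalize hT
      have hne : ∀ x ∈ S ∩ T, x ≠ u := fun x hx h => hS'.2 (h ▸ hx.1)
      refine hG v (by simp [hv]) S T hS'.1 hT'.1 hvS hvT ⟨w, a, b, hab, ?_, ?_, hw, ha, hb⟩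
      · exact (locallyChordalize_adj_of_ne (hne w hw) (hne a ha)).1 hwa
      · exact (locallyChordalize_adj_of_ne (hne w hw) (hne b hb)).1 hwb)
    refine ⟨(le_locallyChordalize G u).trans h1, fun T hT => ?_, fun a b hab hG => ?_⟩
    · obtain ⟨hT1, hT2⟩ := h2 T hT
      obtain ⟨hT3, hT4⟩ := hu.isHole_of_locallyChordalize hT1
      refine ⟨hT3, fun v hv => ?_⟩
      rcases List.mem_cons.1 hv with rfl | hv
      · exact hT4
      · exact hT2 v hv
    · by_cases h : (locallyChordalize G u).Adj a b
      · obtain ⟨-, h', hS⟩ := (locallyChordalize_adj.1 h).resolve_left hG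
        exact ⟨h'.imp (by rintro rfl; simp) (by rintro rfl; simp), hS⟩
      · obtain ⟨h', S, hS, ha, hb⟩ := h3 a b hab h
        exact ⟨h'.imp (List.mem_cons_of_mem _) (List.mem_cons_of_mem _), S,
          (hu.isHole_of_locallyChordalize hS).1, ha, hb⟩

theorem IsChordalizationBy.properties {C : Set V} {G' : SimpleGraph V}
    (h : IsChordalizationBy G C G') (hC : SetNC G C) :
    G ≤ G' ∧ (∀ T, IsHole G' T → IsHole G T ∧ ∀ u ∈ C, u ∉ T) ∧
    ∀ a b, G'.Adj a b → ¬ G.Adj a b → (a ∈ C ∨ b ∈ C) ∧ ∃ S, IsHole G S ∧ a ∈ S ∧ b ∈ S := by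
  obtain ⟨l, -, rfl, rfl⟩ := h
  exact foldl_locallyChordalize l G hC.1

theorem IsChordalizationBy.isChordal {C : Set V} {G' : SimpleGraph V}
    (h : IsChordalizationBy G C G') (hC : SetNC G C) (hcov : IsHoleCover G C) : IsChordal G' := by
  intro T hT
  obtain ⟨hT1, hT2⟩ := (h.properties hC).2.1 T hT
  obtain ⟨v, hvT, hvC⟩ := hcov.2 T hT1
  exact hT2 v hvC hvT

/-! ### Cliques of the chordalized graph -/

/-- If holes through `u₁` and `u₂` both contain a vertex `b` that is adjacent to neither, and no
hole contains both `u₁` and `u₂`, then the NC property forbids that `u₁` and `u₂` are adjacent. -/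
theorem SetNC.not_adj_of_common {C : Set V} (hC : SetNC G C) {u₁ u₂ b : V} (h1 : u₁ ∈ C)
    (h2 : u₂ ∈ C) (hne1 : u₁ ≠ b) (hne2 : u₂ ≠ b) (hb1 : ¬ G.Adj u₁ b) (hb2 : ¬ G.Adj u₂ b)
    {S₁ S₂ : Set V} (hS1 : IsHole G S₁) (hS2 : IsHole G S₂) (hu1 : u₁ ∈ S₁) (hu2 : u₂ ∈ S₂)
    (hbS1 : b ∈ S₁) (hbS2 : b ∈ S₂) : ¬ G.Adj u₁ u₂ := by
  intro hadj
  have hnotboth : ∀ S, IsHole G S → u₁ ∈ S → u₂ ∉ S := fun S hS h h' =>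
    hadj.ne (hC.2 S hS ⟨h, h1⟩ ⟨h', h2⟩)
  have h21 : u₂ ∉ S₁ := hnotboth S₁ hS1 hu1
  have h12 : u₁ ∉ S₂ := fun h => hnotboth S₂ hS2 h hu2
  -- Each of `u₁`, `u₂` sees at most one arc of the hole through the other vertex.
  have hfree : ∀ x ∈ C, ∀ v S, IsHole G S → v ∈ S → b ∈ S → v ≠ b → ¬ G.Adj v b → x ∉ S →
      ¬ G.Adj x b → ∃ A, IsArc G v b A ∧ A ⊆ S ∧ ∀ a ∈ A, ¬ G.Adj x a := by
    intro x hx v S hS hv hb hvb hvb' hxS hxb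
    obtain ⟨A, B, hAB⟩ := hS.exists_isSplit hv hb hvb hvb'
    by_cases hA : ∃ a ∈ A, G.Adj x a
    · by_cases hB : ∃ a ∈ B, G.Adj x a
      · obtain ⟨T, hT, hxT, -, -, hshare⟩ := hAB.exists_isHole hxS hxb hA hB
        exact absurd hshare (hC.1 x hx T S hT hS hxT hxS)
      · push Not at hB
        exact ⟨B, hAB.arc', by rw [hAB.eq]; exact fun _ h => Or.inr (Or.inr (Or.inr h)), hB⟩
    · push Not at hA
      exact ⟨A, hAB.arc, by rw [hAB.eq]; exact fun _ h => Or.inr (Or.inr (Or.inl h)), hA⟩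
  obtain ⟨A₁, hA₁, hA₁S, hA₁n⟩ := hfree u₂ h2 u₁ S₁ hS1 hu1 hbS1 hne1 hb1 h21 hb2
  obtain ⟨A₂, hA₂, hA₂S, hA₂n⟩ := hfree u₁ h1 u₂ S₂ hS2 hu2 hbS2 hne2 hb2 h12 hb1
  obtain ⟨a, ha, hua, -⟩ := hA₁.left
  obtain ⟨c, hc, hbc, -⟩ := hA₁.right
  obtain ⟨d, hd, hud, -⟩ := hA₂.left
  obtain ⟨e, he, hbe, -⟩ := hA₂.right
  -- A path from `u₂` through the free arcs to a neighbour of `u₁` gives a hole through both.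
  have hlink : LinkedIn G ({u₂} ∪ A₂ ∪ {b} ∪ A₁) u₂ a :=
    linkedIn_union (linkedIn_union_self (linkedIn_union_self linkedIn_singleton hA₂.linked
      ⟨d, hd, Or.inr ⟨u₂, rfl, hud⟩⟩) linkedIn_singleton
      ⟨b, rfl, Or.inr ⟨e, Or.inr he, hbe.symm⟩⟩) hA₁.linked
      ⟨c, hc, Or.inr ⟨b, Or.inr rfl, hbc⟩⟩ u₂ (Or.inl (Or.inl rfl)) a ha
  obtain ⟨T, hT, hT1, -, ⟨_, hT2, rfl⟩, -, -⟩ := exists_isHole_of_linkedIn (x := u₁) (A := {u₂})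
    (B := {y | y ∈ A₁ ∧ G.Adj u₁ y}) (by
      rintro (((h | h) | h) | h)
      exacts [hadj.ne h, h12 (hA₂S h), hne1 h, hA₁.left_notMem h]) hlink rfl ⟨ha, hua⟩
    (by rintro _ rfl; exact hadj) (fun y hy => hy.2)
    (by
      rintro y (((h | h) | h) | h) hy
      · exact Or.inl h
      · exact absurd hy (hA₂n y h)
      · exact absurd (h ▸ hy) hb1
      · exact Or.inr ⟨h, hy⟩)
    (by
      rintro _ rfl y hy
      exact ⟨fun h => h21 (h ▸ hA₁S hy.1), hA₁n y hy.1⟩)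
  exact hnotboth T hT hT1 hT2

/-- A four-cycle without chords is a hole. -/
theorem isHole_of_four {a b c d : V} (hab : G.Adj a b) (hbc : G.Adj b c) (hcd : G.Adj c d)
    (hda : G.Adj d a) (hac : a ≠ c) (hbd : b ≠ d) (hac' : ¬ G.Adj a c) (hbd' : ¬ G.Adj b d) :
    ∃ T, IsHole G T ∧ a ∈ T ∧ b ∈ T := by
  have hlink : LinkedIn G {b, c, d} b d :=
    (linkedIn_of_adj hbc (by simp) (by simp)).trans (linkedIn_of_adj hcd (by simp) (by simp))
  obtain ⟨T, hT, haT, -, ⟨_, hbT, rfl⟩, -, -⟩ := exists_isHole_of_linkedIn (x := a) (A := {b})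
    (B := {d}) (by
      rintro (h | h | h)
      exacts [hab.ne h, hac h, hda.ne h.symm]) hlink rfl rfl (by rintro _ rfl; exact hab)
    (by rintro _ rfl; exact hda.symm)
    (by
      rintro y (h | h | h) hy
      · exact Or.inl h
      · exact absurd (h ▸ hy) hac'
      · exact Or.inr h)
    (by rintro _ rfl _ rfl; exact ⟨hbd, hbd'⟩)
  exact ⟨T, hT, haT, hbT⟩

/-- The new edges inside a clique of the chordalized graph all share one vertex, so deleting that
vertex leaves a clique of the original graph. -/
theorem IsChordalizationBy.exists_isClique {C : Set V} {G' : SimpleGraph V}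
    (h : IsChordalizationBy G C G') (hC : SetNC G C) {K : Set V} (hK : G'.IsClique K)
    (hne : K.Nonempty) : ∃ v, G.IsClique (K \ {v}) := by
  obtain ⟨-, -, hnew⟩ := h.properties hC
  have hnotboth : ∀ S, IsHole G S → ∀ x ∈ S, ∀ y ∈ S, x ∈ C → y ∈ C → x = y :=
    fun S hS x hx y hy hxC hyC => hC.2 S hS ⟨hx, hxC⟩ ⟨hy, hyC⟩
  have hnew' : ∀ x ∈ K, ∀ y ∈ K, x ≠ y → ¬ G.Adj x y →
      ((x ∈ C ∧ y ∉ C) ∨ (x ∉ C ∧ y ∈ C)) ∧ ∃ S, IsHole G S ∧ x ∈ S ∧ y ∈ S := by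
    intro x hx y hy hxy hadj
    obtain ⟨hor, S, hS, hxS, hyS⟩ := hnew x y (hK hx hy hxy) hadj
    have := hnotboth S hS x hxS y hyS
    exact ⟨by tauto, S, hS, hxS, hyS⟩
  have huniq : ∀ u₁ ∈ K, ∀ b₁ ∈ K, ∀ u₂ ∈ K, ∀ b₂ ∈ K, u₁ ∈ C → b₁ ∉ C → u₂ ∈ C → b₂ ∉ C →
      ¬ G.Adj u₁ b₁ → ¬ G.Adj u₂ b₂ → u₁ = u₂ := by
    intro u₁ hu₁ b₁ hb₁ u₂ hu₂ b₂ hb₂ hu₁C hb₁C hu₂C hb₂C h₁ h₂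
    by_contra hne
    have hn : ∀ u ∈ C, ∀ b ∉ C, u ≠ b := fun u hu b hb h => hb (h ▸ hu)
    have huu : G.Adj u₁ u₂ := by
      by_contra hcon
      rcases (hnew' u₁ hu₁ u₂ hu₂ hne hcon).1 with h | h
      · exact h.2 hu₂C
      · exact h.1 hu₁C
    have hcommon : ∀ b ∈ K, b ∉ C → ¬ G.Adj u₁ b → ¬ G.Adj u₂ b → False := by
      intro b hb hbC h1 h2
      obtain ⟨-, S, hS, huS, hbS⟩ := hnew' u₁ hu₁ b hb (hn _ hu₁C _ hbC) h1
      obtain ⟨-, S', hS', huS', hbS'⟩ := hnew' u₂ hu₂ b hb (hn _ hu₂C _ hbC) h2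
      exact hC.not_adj_of_common hu₁C hu₂C (hn _ hu₁C _ hbC) (hn _ hu₂C _ hbC) h1 h2 hS hS' huS
        huS' hbS hbS' huu
    have h21 : G.Adj u₂ b₁ := by_contra fun hcon => hcommon b₁ hb₁ hb₁C h₁ hcon
    have h12 : G.Adj u₁ b₂ := by_contra fun hcon => hcommon b₂ hb₂ hb₂C hcon h₂
    have hbne : b₁ ≠ b₂ := fun h => h₁ (h ▸ h12)
    have hbb : G.Adj b₁ b₂ := by
      by_contra hcon
      rcases (hnew' b₁ hb₁ b₂ hb₂ hbne hcon).1 with h | h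
      · exact hb₁C h.1
      · exact hb₂C h.2
    obtain ⟨T, hT, h1, h2⟩ := isHole_of_four huu h21 hbb h12.symm (hn _ hu₁C _ hb₁C)
      (hn _ hu₂C _ hb₂C) h₁ h₂
    exact hne (hnotboth T hT _ h1 _ h2 hu₁C hu₂C)
  by_cases hex : ∃ u ∈ K, ∃ b ∈ K, u ∈ C ∧ b ∉ C ∧ ¬ G.Adj u b
  · obtain ⟨u, hu, b, hb, huC, hbC, hub⟩ := hex
    refine ⟨u, fun x hx y hy hxy => ?_⟩
    by_contra hcon
    rcases (hnew' x hx.1 y hy.1 hxy hcon).1 with h | h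
    · exact hx.2 (huniq x hx.1 y hy.1 u hu b hb h.1 h.2 huC hbC hcon hub)
    · exact hy.2 (huniq y hy.1 x hx.1 u hu b hb h.2 h.1 huC hbC (fun h => hcon h.symm) hub)
  · push Not at hex
    obtain ⟨v, -⟩ := hne
    refine ⟨v, fun x hx y hy hxy => ?_⟩
    by_contra hcon
    rcases (hnew' x hx.1 y hy.1 hxy hcon).1 with h | h
    · exact hcon (hex x hx.1 y hy.1 h.1 h.2)
    · exact hcon (hex y hy.1 x hx.1 h.2 h.1).symm

/-! ### Cliques along a local chordalization partition -/

/-- Every clique of `G'` becomes a clique of `G` after deleting at most `d` vertices. -/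
def CliqueLossLE (G G' : SimpleGraph V) (d : ℕ) : Prop :=
  ∀ K : Finset V, G'.IsClique K → ∃ K' ⊆ K, G.IsClique K' ∧ K.card ≤ K'.card + d

theorem IsChordalizationBy.cliqueLossLE {C : Set V} {G' : SimpleGraph V}
    (h : IsChordalizationBy G C G') (hC : SetNC G C) : CliqueLossLE G G' 1 := by
  classical
  intro K hK
  rcases K.eq_empty_or_nonempty with rfl | hne
  · exact ⟨∅, subset_rfl, by simp, by simp⟩
  · obtain ⟨v, hv⟩ := h.exists_isClique hC hK (by simpa using hne)
    refine ⟨K.erase v, K.erase_subset v, by simpa using hv, ?_⟩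
    have := K.pred_card_le_card_erase (a := v)
    omega

theorem deleteSet_adj {X : Set V} {a b : V} :
    (deleteSet G X).Adj a b ↔ G.Adj a b ∧ a ∉ X ∧ b ∉ X := by
  simp only [deleteSet, SimpleGraph.map_adj, SimpleGraph.comap_adj,
    Function.Embedding.subtype_apply, Subtype.exists]
  constructor
  · rintro ⟨x, hx, y, hy, h, rfl, rfl⟩
    exact ⟨h, hx, hy⟩
  · rintro ⟨h, ha, hb⟩
    exact ⟨a, ha, b, hb, h, rfl, rfl⟩

/-- The stages of a local chordalization partition, with `X` the set of vertices still missing: no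
vertex of `X` has an edge, all edges of `G - X` are present, and every clique becomes a clique of
`G` after deleting at most `d` vertices. -/
structure IsStage (G : SimpleGraph V) (X : Set V) (d : ℕ) (H : SimpleGraph V) : Prop where
  le : deleteSet G X ≤ H
  notMem : ∀ a b, H.Adj a b → a ∉ X
  cliqueLossLE : CliqueLossLE G H d

theorem isStage_deleteSet (G : SimpleGraph V) (X : Set V) : IsStage G X 0 (deleteSet G X) where
  le := le_rfl
  notMem _ _ h := (deleteSet_adj.1 h).2.1
  cliqueLossLE K hK := ⟨K, subset_rfl, hK.mono fun _ _ h => (deleteSet_adj.1 h).1, by simp⟩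

/-- Adding the missing vertices of `Y` with their edges in `G - X` does not increase the number of
vertices to be deleted from a clique. -/
theorem IsStage.sup {X Y : Set V} {d : ℕ} {H : SimpleGraph V} (h : IsStage G (Y ∪ X) d H) :
    IsStage G X d (H ⊔ deleteSet G X) where
  le := le_sup_right
  notMem a b hab := by
    rcases hab with hab | hab
    · exact fun ha => h.notMem a b hab (Or.inr ha)
    · exact (deleteSet_adj.1 hab).2.1
  cliqueLossLE := by
    classical
    intro K hK
    -- An edge with an end in `Y` is an edge of `G`; the other edges are edges of `H`.
    have hold : H.IsClique (K.filter (· ∉ Y) : Finset V) := by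
      intro a ha b hb hab
      simp only [Finset.coe_filter, Set.mem_ofPred_eq] at ha hb
      rcases hK ha.1 hb.1 hab with h' | h'
      · exact h'
      · obtain ⟨h1, h2, h3⟩ := deleteSet_adj.1 h'
        exact h.le (deleteSet_adj.2 ⟨h1, by rintro (h | h); exacts [ha.2 h, h2 h],
          by rintro (h | h); exacts [hb.2 h, h3 h]⟩)
    have hnew : ∀ a b, a ∈ Y → (H ⊔ deleteSet G X).Adj a b → G.Adj a b := by
      rintro a b ha (hab | hab)
      · exact absurd (Or.inl ha) (h.notMem a b hab)
      · exact (deleteSet_adj.1 hab).1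
    obtain ⟨K', hK', hcl, hcard⟩ := h.cliqueLossLE _ hold
    have hK'K : K' ⊆ K := hK'.trans (K.filter_subset _)
    refine ⟨K' ∪ K.filter (· ∈ Y), Finset.union_subset hK'K (K.filter_subset _), ?_, ?_⟩
    · intro a ha b hb hab
      simp only [Finset.coe_union, Finset.coe_filter, Set.mem_union, Finset.mem_coe,
        Set.mem_ofPred_eq] at ha hb
      rcases ha with ha | ha
      · rcases hb with hb | hb
        · exact hcl ha hb hab
        · exact (hnew b a hb.2 (hK hb.1 (hK'K ha) hab.symm)).symm
      · exact hnew a b ha.2 (hK ha.1 (hb.elim (fun h => hK'K h) (·.1)) hab)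
    · rw [Finset.card_union_of_disjoint]
      · have := K.card_filter_add_card_filter_not (· ∈ Y)
        omega
      · rw [Finset.disjoint_left]
        intro a ha ha'
        exact (Finset.mem_filter.1 (hK' ha)).2 (Finset.mem_filter.1 ha').2

theorem IsStage.chordalize {X C : Set V} {d : ℕ} {H H' : SimpleGraph V} (h : IsStage G X d H)
    (hC : SetNC H C) (hH : IsChordalizationBy H C H') : IsStage G X (d + 1) H' where
  le := h.le.trans (hH.properties hC).1
  notMem a b hab := by
    by_cases hadj : H.Adj a b
    · exact h.notMem a b hadj
    · obtain ⟨-, S, hS, ha, -⟩ := (hH.properties hC).2.2 a b hab hadj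
      obtain ⟨c, hc⟩ := hS.exists_adj ha
      exact h.notMem a c hc
  cliqueLossLE K hK := by
    obtain ⟨K₁, h1, h2, h3⟩ := hH.cliqueLossLE hC K hK
    obtain ⟨K₂, h4, h5, h6⟩ := h.cliqueLossLE K₁ h2
    exact ⟨K₂, h4.trans h1, h5, by omega⟩

theorem IsLocalChordalizationPartition.exists_isChordal {A : Set V} {k : ℕ} {C : Fin k → Set V}
    (h : IsLocalChordalizationPartition G A k C) :
    ∃ G', G ≤ G' ∧ IsChordal G' ∧ CliqueLossLE G G' k := by
  obtain ⟨hA, -, hCA, H, Gs, h0, hstep⟩ := h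
  have hk : k ≠ 0 := by
    rintro rfl
    obtain ⟨v, hv⟩ := hA.1
    simp [← hCA] at hv
  have key : ∀ i : Fin (k + 1),
      IsStage G (⋃ (j : Fin k) (_ : i ≤ j.castSucc), C j) i (Gs i) := by
    intro i
    induction i using Fin.induction with
    | zero =>
      have hX : (⋃ (j : Fin k) (_ : (0 : Fin (k + 1)) ≤ j.castSucc), C j) = A := by simp [← hCA]
      rw [hX, h0]
      exact isStage_deleteSet G A
    | succ i ih =>
      obtain ⟨hH, -, hNC, hchord, -⟩ := hstep i
      have hX : (⋃ (j : Fin k) (_ : i.castSucc ≤ j.castSucc), C j) =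
          C i ∪ ⋃ (j : Fin k) (_ : i < j), C j := by
        ext v
        simp only [Set.mem_iUnion, Set.mem_union, Fin.castSucc_le_castSucc_iff, exists_prop]
        constructor
        · rintro ⟨j, hij, hv⟩
          rcases hij.eq_or_lt with rfl | hij
          · exact Or.inl hv
          · exact Or.inr ⟨j, hij, hv⟩
        · rintro (hv | ⟨j, hij, hv⟩)
          · exact ⟨i, le_rfl, hv⟩
          · exact ⟨j, hij.le, hv⟩
      have hX' : (⋃ (j : Fin k) (_ : i.succ ≤ j.castSucc), C j) =
          ⋃ (j : Fin k) (_ : i < j), C j := by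
        simp only [Fin.succ_le_castSucc_iff]
      rw [hX] at ih
      rw [hX', Fin.val_succ]
      exact (hH ▸ ih.sup).chordalize hNC hchord
  have hlast := key (Fin.last k)
  refine ⟨Gs (Fin.last k), fun a b hab => hlast.le (deleteSet_adj.2 ⟨hab, ?_, ?_⟩), ?_,
    hlast.cliqueLossLE⟩
  · simp only [Set.mem_iUnion, not_exists]
    intro j hj
    exact absurd hj (not_le.2 (Fin.castSucc_lt_last j))
  · simp only [Set.mem_iUnion, not_exists]
    intro j hj
    exact absurd hj (not_le.2 (Fin.castSucc_lt_last j))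
  · obtain ⟨m, rfl⟩ := Nat.exists_eq_succ_of_ne_zero hk
    exact (hstep (Fin.last m)).2.2.2.2

theorem exists_isChordal_of_nonChordalityIndex_le {k : ℕ}
    (h : nonChordalityIndex G ≤ (k : ℕ∞)) :
    ∃ G', G ≤ G' ∧ IsChordal G' ∧ CliqueLossLE G G' k := by
  by_cases hG : IsChordal G
  · exact ⟨G, le_rfl, hG, fun K hK => ⟨K, subset_rfl, hK, by omega⟩⟩
  rw [nonChordalityIndex, if_neg hG] at h
  have : ∃ m ≤ k, ∃ (A : Set V) (C : Fin m → Set V), IsLocalChordalizationPartition G A m C := by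
    by_contra hcon
    push Not at hcon
    have hle : ((k + 1 : ℕ) : ℕ∞) ≤ ⨅ (k : ℕ) (_ : ∃ (A : Set V) (C : Fin k → Set V),
        IsLocalChordalizationPartition G A k C), (k : ℕ∞) := by
      refine le_iInf₂ fun m ⟨A, C, hm⟩ => ?_
      rw [Nat.cast_le]
      by_contra hlt
      exact hcon m (by omega) A C hm
    have := Nat.cast_le.1 (hle.trans h)
    omega
  obtain ⟨m, hm, A, C, hAC⟩ := this
  obtain ⟨G', h1, h2, h3⟩ := hAC.exists_isChordal
  refine ⟨G', h1, h2, fun K hK => ?_⟩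
  obtain ⟨K', h4, h5, h6⟩ := h3 K hK
  exact ⟨K', h4, h5, by omega⟩

theorem HasNC.exists_isChordal [Finite V] (h : HasNC G) :
    ∃ G', G ≤ G' ∧ IsChordal G' ∧ CliqueLossLE G G' 1 := by
  obtain ⟨C, hcov, hC⟩ := h
  have hch : IsChordalizationBy G C
      (C.toFinite.toFinset.toList.foldl locallyChordalize G) :=
    ⟨_, Finset.nodup_toList _, by ext; simp, rfl⟩
  exact ⟨_, (hch.properties hC).1, hch.isChordal hC hcov, hch.cliqueLossLE hC⟩

/-! ### Colouring chordal graphs -/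

/-- A chordal graph has a simplicial vertex in every nonempty finite set `D` of vertices, i.e. one
whose neighbours in `D` form a clique. Fix `v ∈ D`. If `v` is adjacent to all other vertices of `D`,
a simplicial vertex of the rest will do. Otherwise take a largest connected `K ⊆ D` that contains
`v` and does not dominate `D`. By maximality every vertex of the boundary of `K` is adjacent to all
undominated vertices; hence the boundary is a clique, as `G` has no holes, and a simplicial vertex
of the undominated part is simplicial in `D`. -/
theorem IsChordal.exists_simplicial (hG : IsChordal G) (D : Finset V) (hD : D.Nonempty) :
    ∃ x ∈ D, G.IsClique {y | y ∈ D ∧ G.Adj x y} := by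
  classical
  induction hc : D.card using Nat.strong_induction_on generalizing D with
  | _ n ih =>
  subst hc
  obtain ⟨v, hv⟩ := hD
  by_cases hdom : ∀ w ∈ D, w ≠ v → G.Adj v w
  · rcases (D.erase v).eq_empty_or_nonempty with hE | hE
    · refine ⟨v, hv, fun x hx => ?_⟩
      have : x ∈ D.erase v := Finset.mem_erase.2 ⟨hx.2.ne', hx.1⟩
      simp [hE] at this
    · obtain ⟨x, hx, hcl⟩ := ih _ (Finset.card_erase_lt_of_mem hv) _ hE rfl
      have hx' := Finset.mem_erase.1 hx
      refine ⟨x, hx'.2, fun a ha b hb hab => ?_⟩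
      by_cases hav : a = v
      · subst hav
        exact hdom b hb.1 hab.symm
      · by_cases hbv : b = v
        · subst hbv
          exact (hdom a ha.1 hab).symm
        · exact hcl ⟨Finset.mem_erase.2 ⟨hav, ha.1⟩, ha.2⟩
            ⟨Finset.mem_erase.2 ⟨hbv, hb.1⟩, hb.2⟩ hab
  · push Not at hdom
    obtain ⟨w, hw, hwv, hvw⟩ := hdom
    let far : Finset V → Finset V := fun K => D.filter fun d => d ∉ K ∧ ∀ y ∈ K, ¬ G.Adj y d
    let good : Finset (Finset V) := D.powerset.filter fun K =>
      v ∈ K ∧ (∀ x ∈ (K : Set V), ∀ y ∈ (K : Set V), LinkedIn G K x y) ∧ (far K).Nonempty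
    have hgood : good.Nonempty := by
      refine ⟨{v}, Finset.mem_filter.2 ⟨by simpa using hv, by simp, ?_, ⟨w, ?_⟩⟩⟩
      · rw [Finset.coe_singleton]
        exact linkedIn_singleton
      · simpa [far] using ⟨hw, hwv, hvw⟩
    obtain ⟨K, hKgood, hmax⟩ := good.exists_max_image Finset.card hgood
    obtain ⟨hKD, hvK, hK, hfar⟩ := Finset.mem_filter.1 hKgood
    rw [Finset.mem_powerset] at hKD
    have hfarD : far K ⊆ D := Finset.filter_subset _ _
    have hlt : (far K).card < D.card :=
      Finset.card_lt_card ⟨hfarD, fun h => (Finset.mem_filter.1 (h hv)).2.1 hvK⟩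
    obtain ⟨x, hx, hcl⟩ := ih _ hlt _ hfar rfl
    -- The boundary of `K` consists of the dominated vertices outside `K`.
    have hbd : ∀ b ∈ D, b ∉ far K → b ∉ K → ∃ y ∈ K, G.Adj y b := by
      intro b hb hbf hbK
      by_contra hcon
      push Not at hcon
      exact hbf (Finset.mem_filter.2 ⟨hb, hbK, hcon⟩)
    have hcomplete : ∀ b ∈ D, b ∉ far K → b ∉ K → ∀ d ∈ far K, G.Adj b d := by
      intro b hb hbf hbK d hd
      by_contra hbd'
      obtain ⟨y, hy, hyb⟩ := hbd b hb hbf hbK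
      obtain ⟨hdD, hdK, hd⟩ := Finset.mem_filter.1 hd
      have hmem : insert b K ∈ good := by
        refine Finset.mem_filter.2 ⟨?_, Finset.mem_insert_of_mem hvK, ?_, d, ?_⟩
        · exact Finset.mem_powerset.2 (Finset.insert_subset hb hKD)
        · have hcoe : ((insert b K : Finset V) : Set V) = ↑K ∪ {b} := by
            rw [Finset.coe_insert, Set.union_singleton]
          rw [hcoe]
          exact linkedIn_union_self hK linkedIn_singleton ⟨b, rfl, Or.inr ⟨y, hy, hyb⟩⟩
        · refine Finset.mem_filter.2 ⟨hdD, ?_, ?_⟩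
          · rw [Finset.mem_insert]
            rintro (rfl | h)
            · exact hbf (Finset.mem_filter.2 ⟨hdD, hdK, hd⟩)
            · exact hdK h
          · intro z hz
            rcases Finset.mem_insert.1 hz with rfl | hz
            · exact hbd'
            · exact hd z hz
      have := hmax _ hmem
      rw [Finset.card_insert_of_notMem hbK] at this
      omega
    have hxfar := Finset.mem_filter.1 hx
    have hxK : ∀ a, G.Adj x a → a ∉ K := fun a ha haK => hxfar.2.2 a haK ha.symm
    have hclique : ∀ a ∈ D, a ∉ far K → a ∉ K → ∀ b ∈ D, b ∉ far K → b ∉ K → a ≠ b →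
        G.Adj a b := by
      intro a ha haf haK b hb hbf hbK hab
      by_contra hcon
      obtain ⟨y, hy, hya⟩ := hbd a ha haf haK
      obtain ⟨z, hz, hzb⟩ := hbd b hb hbf hbK
      have hlink : LinkedIn G ({a} ∪ ↑K ∪ {b}) a b :=
        linkedIn_union (linkedIn_union_self linkedIn_singleton hK
          ⟨y, hy, Or.inr ⟨a, rfl, hya.symm⟩⟩) linkedIn_singleton
          ⟨b, rfl, Or.inr ⟨z, Or.inr hz, hzb⟩⟩ a (Or.inl rfl) b rfl
      have hxa := (hcomplete a ha haf haK x hx).symm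
      have hxb := (hcomplete b hb hbf hbK x hx).symm
      obtain ⟨T, hT, -⟩ := exists_isHole_of_linkedIn (x := x) (A := {a}) (B := {b}) (by
          rintro ((h | h) | h)
          exacts [hxa.ne h, hxfar.2.1 h, hxb.ne h]) hlink rfl rfl
        (by rintro _ rfl; exact hxa) (by rintro _ rfl; exact hxb)
        (by
          rintro c ((h | h) | h) hxc
          · exact Or.inl h
          · exact absurd h (hxK c hxc)
          · exact Or.inr h)
        (by rintro _ rfl _ rfl; exact ⟨hab, hcon⟩)
      exact hG T hT
    refine ⟨x, hxfar.1, fun a ha b hb hab => ?_⟩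
    by_cases haf : a ∈ far K
    · by_cases hbf : b ∈ far K
      · exact hcl ⟨haf, ha.2⟩ ⟨hbf, hb.2⟩ hab
      · exact (hcomplete b hb.1 hbf (hxK b hb.2) a haf).symm
    · by_cases hbf : b ∈ far K
      · exact hcomplete a ha.1 haf (hxK a ha.2) b hbf
      · exact hclique a ha.1 haf (hxK a ha.2) b hb.1 hbf (hxK b hb.2) hab

/-- Colour greedily along a perfect elimination order: each neighbour coloured earlier forbids at
most one colour, and there are fewer of these than the clique number. -/
theorem IsChordal.dpColorable [Finite V] (hG : IsChordal G) : DPColorable G G.cliqueNum := by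
  classical
  intro L
  rcases isEmpty_or_nonempty V with hV | ⟨⟨v₀⟩⟩
  · exact ⟨fun v => hV.elim v, fun v => hV.elim v⟩
  have hpos : 0 < G.cliqueNum := by
    have : G.IsClique (({v₀} : Finset V) : Set V) := by simp
    simpa [Nat.one_le_iff_ne_zero, Nat.pos_iff_ne_zero] using this.card_le_cliqueNum
  have : Nonempty (Fin G.cliqueNum) := ⟨⟨0, hpos⟩⟩
  have key : ∀ (n : ℕ) (s : Finset V), s.card = n → ∃ f : V → Fin G.cliqueNum,
      ∀ u ∈ s, ∀ v ∈ s, G.Adj u v → ¬ L.M u v (f u) (f v) := by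
    intro n
    induction n with
    | zero =>
      intro s hs
      rw [Finset.card_eq_zero] at hs
      subst hs
      exact ⟨fun _ => Classical.arbitrary _, by simp⟩
    | succ n ih =>
      intro s hs
      obtain ⟨w, hw, hcl⟩ := hG.exists_simplicial s (Finset.card_pos.1 (by omega))
      obtain ⟨f, hf⟩ := ih (s.erase w) (by rw [Finset.card_erase_of_mem hw]; omega)
      let N : Finset V := s.filter fun y => G.Adj w y
      have hNcl : G.IsClique ((insert w N : Finset V) : Set V) := by
        rw [Finset.coe_insert]
        refine SimpleGraph.IsClique.insert (hcl.subset ?_) ?_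
        · intro y hy
          simpa [N] using hy
        · intro y hy _
          exact (Finset.mem_filter.1 hy).2
      have hNcard : N.card < G.cliqueNum := by
        have := hNcl.card_le_cliqueNum
        rw [Finset.card_insert_of_notMem (by simp [N])] at this
        omega
      -- `g u` is the colour at `w` matched with the colour of `u`, if there is one.
      let g : V → Fin G.cliqueNum := fun u =>
        if h : ∃ b, L.M u w (f u) b then h.choose else Classical.arbitrary _
      obtain ⟨c, -, hc⟩ := Finset.exists_mem_notMem_of_card_lt_card
        (s := N.image g) (t := Finset.univ)
        (by simpa using Finset.card_image_le.trans_lt hNcard)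
      have hcw : ∀ u ∈ s, G.Adj u w → ¬ L.M u w (f u) c := by
        intro u hu ha hm
        refine hc (Finset.mem_image.2 ⟨u, Finset.mem_filter.2 ⟨hu, ha.symm⟩, ?_⟩)
        have h : ∃ b, L.M u w (f u) b := ⟨c, hm⟩
        simp only [g, dif_pos h]
        exact L.matching u w _ _ _ ha h.choose_spec hm
      refine ⟨Function.update f w c, fun u hu v hv ha => ?_⟩
      by_cases huw : u = w
      · subst huw
        rw [Function.update_self, Function.update_of_ne ha.ne']
        exact fun hm => hcw v hv ha.symm (L.symm _ _ _ _ ha hm)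
      · by_cases hvw : v = w
        · subst hvw
          rw [Function.update_self, Function.update_of_ne huw]
          exact hcw u hu ha
        · rw [Function.update_of_ne huw, Function.update_of_ne hvw]
          exact hf u (Finset.mem_erase.2 ⟨huw, hu⟩) v (Finset.mem_erase.2 ⟨hvw, hv⟩) ha
  have := Fintype.ofFinite V
  obtain ⟨f, hf⟩ := key _ Finset.univ rfl
  exact ⟨f, fun u v => hf u (Finset.mem_univ _) v (Finset.mem_univ _)⟩

theorem DPColorable.mono {G G' : SimpleGraph V} {k : ℕ} (h : G ≤ G') (hG' : DPColorable G' k) :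
    DPColorable G k := by
  intro L
  obtain ⟨f, hf⟩ := hG'
    { M := fun u v a b => G.Adj u v ∧ L.M u v a b
      symm := fun u v a b _ h => ⟨h.1.symm, L.symm u v a b h.1 h.2⟩
      matching := fun u v a b b' _ h h' => L.matching u v a b b' h.1 h.2 h'.2 }
  exact ⟨f, fun u v ha hm => hf u v (h ha) ⟨ha, hm⟩⟩

theorem IsChordal.induce (hG : IsChordal G) (s : Set V) : IsChordal (G.induce s) := by
  rintro _ ⟨n, hn, φ, rfl⟩
  exact hG _ ⟨n, hn, φ.trans (SimpleGraph.Embedding.induce s), rfl⟩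

theorem cliqueNum_induce_le_add [Finite V] {G G' : SimpleGraph V} {d : ℕ}
    (h : CliqueLossLE G G' d) (s : Set V) :
    (G'.induce s).cliqueNum ≤ (G.induce s).cliqueNum + d := by
  classical
  obtain ⟨K, hK⟩ := (G'.induce s).exists_isNClique_cliqueNum
  obtain ⟨K', hK', hcl, hcard⟩ := h (K.map (Function.Embedding.subtype _)) (by
    intro a ha b hb hab
    simp only [Finset.coe_map, Set.mem_image, Finset.mem_coe] at ha hb
    obtain ⟨a, ha, rfl⟩ := ha
    obtain ⟨b, hb, rfl⟩ := hb
    exact hK.isClique ha hb fun h => hab (by rw [h]))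
  have hK's : ∀ x ∈ K', x ∈ s := by
    intro x hx
    obtain ⟨y, -, rfl⟩ := Finset.mem_map.1 (hK' hx)
    exact y.2
  have hcl' : (G.induce s).IsClique (K'.subtype (· ∈ s) : Finset s) := by
    intro a ha b hb hab
    exact hcl (by simpa using ha) (by simpa using hb) fun h => hab (Subtype.ext h)
  have h1 := hcl'.card_le_cliqueNum
  rw [Finset.card_subtype, Finset.filter_true_of_mem hK's] at h1
  rw [Finset.card_map, hK.card_eq] at hcard
  omega

/-- A chordal supergraph bounds the DP-chromatic number of every induced subgraph. -/
theorem dpChromaticNumber_induce_le [Finite V] {d : ℕ}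
    (h : ∃ G', G ≤ G' ∧ IsChordal G' ∧ CliqueLossLE G G' d) (s : Set V) :
    dpChromaticNumber (G.induce s) ≤ (G.induce s).cliqueNum + d := by
  obtain ⟨G', hle, hch, hloss⟩ := h
  refine le_trans (Nat.sInf_le ?_) (cliqueNum_induce_le_add hloss s)
  exact (hch.induce s).dpColorable.mono fun a b hab => hle hab

end NonChordality

theorem mainTheorem6 :
    (∀ (k : ℕ) (F : Set NonChordality.FiniteGraph.{u}),
      (∀ G ∈ F, NonChordality.nonChordalityIndex G.graph ≤ (k : ℕ∞)) →
        NonChordality.IsDPBindingFunction F (fun x : ℕ => (x : ℝ) + (k : ℝ)) ∧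
        NonChordality.IsDPBounded F) ∧
    NonChordality.IsDPBounded
      {G : NonChordality.FiniteGraph.{u} | NonChordality.HasNC G.graph} := by
  refine ⟨fun k F hF => ?_, fun x => (x : ℝ) + 1, fun G hG s => ?_⟩
  · have hb : NonChordality.IsDPBindingFunction F (fun x : ℕ => (x : ℝ) + (k : ℝ)) := by
      intro G hG s
      have := G.finite
      beta_reduce
      exact_mod_cast NonChordality.dpChromaticNumber_induce_le
        (NonChordality.exists_isChordal_of_nonChordalityIndex_le (hF G hG)) s
    exact ⟨hb, _, hb⟩
  · have := G.finite
    beta_reduce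
    exact_mod_cast NonChordality.dpChromaticNumber_induce_le
      (NonChordality.HasNC.exists_isChordal hG) s
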